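/- Let $d\ge 2$ and let $\mathcal M_d$ be the space of complex $d\times d$ matrices. A state is a positive semidefinite matrix of trace one; a channel is a completely positive trace-preserving linear map $T:\mathcal M_d\to\mathcal M_d$. A channel is called primitive if $1$ is its only eigenvalue of modulus one and it has a unique stationary state, which has full rank. For a channel $T$ let $T_\varphi:=\sum_{|\mu|=1}\mu P_\mu$, where the sum is over the eigenvalues $\mu$ of $T$ of modulus one and $P_\mu$ is the spectral projection onto the generalized eigenspace of $\mu$ along the sum of the other generalized eigenspaces. Let $\mathcal L:\mathcal M_d\to\mathcal M_d$ be linear such that $T_t:=e^{t\mathcal L}$ is a channel for every $t\ge 0$ and is primitive for every $t>0$. Let $$\bar\lambda:=\inf\{|\mathrm{Re}\,\lambda| : \lambda\in\mathrm{spec}(\mathcal L),\ \mathrm{Re}\,\lambda<0\}$$ be its gap. For $n\in\mathbb N$ let $\mathcal S^{\rm sep}_n$ be the set of fully separable states, i.e. of all finite convex combinations of product states $\rho_1\otimes\cdots\otimes\rho_n$ with $\rho_i\in\mathcal M_d$ states, and define $$\eta^{\rm sep}_n(t):=\sup_{\rho\in\mathcal S^{\rm sep}_n}\tfrac12\big\|T_t^{\otimes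 n}(\rho)-(T_t)_\varphi^{\otimes n}(\rho)\big\|_1,\qquad \|X\|_1=\mathrm{tr}\sqrt{X^\dagger X}.$$ Then there is a cutoff at the times $t_n:=\log(n)/(2\bar\lambda)$: for every real $c$ with $0<c<1$, $$\lim_{n\to\infty}\eta^{\rm sep}_n(c\,t_n)=1,$$ and for every real $c>1$, $$\lim_{n\to\infty}\eta^{\rm sep}_n(c\,t_n)=0.$$ -/

import Mathlib

noncomputable section

open scoped ComplexOrder MatrixOrder Matrix

namespace QuantumCutoff

/-- A density matrix: positive semidefinite (in particular Hermitian) with trace one. -/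
def IsState {ι : Type*} [Fintype ι] (ρ : Matrix ι ι ℂ) : Prop :=
  ρ.PosSemidef ∧ ρ.trace = 1

/-- The map `id ⊗ T` on matrices over `κ × ι`, i.e. `T` applied to every `ι × ι` block. -/
def ampliate {ι κ : Type*} (T : Module.End ℂ (Matrix ι ι ℂ))
    (X : Matrix (κ × ι) (κ × ι) ℂ) : Matrix (κ × ι) (κ × ι) ℂ :=
  Matrix.of fun a b => T (Matrix.of fun i j => X (a.1, i) (b.1, j)) a.2 b.2

/-- A quantum channel: a completely positive and trace-preserving linear map. -/
structure IsChannel {ι : Type*} [Fintype ι] (T : Module.End ℂ (Matrix ι ι ℂ)) : Prop where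
  completelyPositive : ∀ (k : ℕ) (X : Matrix (Fin k × ι) (Fin k × ι) ℂ),
    X.PosSemidef → (ampliate T X).PosSemidef
  tracePreserving : ∀ X : Matrix ι ι ℂ, (T X).trace = X.trace

/-- A channel is primitive if `1` is its only eigenvalue of modulus one and if it has a unique
stationary state, which moreover has full rank. -/
def IsPrimitive {ι : Type*} [Fintype ι] (T : Module.End ℂ (Matrix ι ι ℂ)) : Prop :=
  (∀ μ : ℂ, T.HasEigenvalue μ → ‖μ‖ = 1 → μ = 1) ∧
  ∃ σ : Matrix ι ι ℂ, IsState σ ∧ T σ = σ ∧ σ.PosDef ∧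
    ∀ ρ : Matrix ι ι ℂ, IsState ρ → T ρ = ρ → ρ = σ

/-- The exponential of a linear map on matrices, computed as the matrix exponential of its
coordinate matrix with respect to the matrix units. -/
def expEnd {ι : Type*} [Fintype ι] [DecidableEq ι] (S : Module.End ℂ (Matrix ι ι ℂ)) :
    Module.End ℂ (Matrix ι ι ℂ) :=
  Matrix.toLin (Matrix.stdBasis ℂ ι ι) (Matrix.stdBasis ℂ ι ι)
    (NormedSpace.exp
      (LinearMap.toMatrix (Matrix.stdBasis ℂ ι ι) (Matrix.stdBasis ℂ ι ι) S))

/-- The semigroup `T_t = e^{tL}` generated by `L`. -/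
def semigroup {ι : Type*} [Fintype ι] [DecidableEq ι] (L : Module.End ℂ (Matrix ι ι ℂ)) (t : ℝ) :
    Module.End ℂ (Matrix ι ι ℂ) :=
  expEnd ((t : ℂ) • L)

/-- The gap `inf {|Re z| : z ∈ Σ(L), Re z < 0}`. -/
def gap {ι : Type*} (L : Module.End ℂ (Matrix ι ι ℂ)) : ℝ :=
  sInf ((fun z : ℂ => |z.re|) '' {z : ℂ | z ∈ spectrum ℂ L ∧ z.re < 0})

theorem isCompl_maxGenEigenspace {V : Type*} [AddCommGroup V] [Module ℂ V]
    [FiniteDimensional ℂ V] (T : Module.End ℂ V) (μ : ℂ) :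
    IsCompl (T.maxGenEigenspace μ) (⨆ ν : ℂ, ⨆ _ : ν ≠ μ, T.maxGenEigenspace ν) := by
  refine ⟨T.independent_maxGenEigenspace μ, ?_⟩
  rw [codisjoint_iff, eq_top_iff, ← T.iSup_maxGenEigenspace_eq_top]
  refine iSup_le fun ν => ?_
  by_cases h : ν = μ
  · subst h
    exact le_sup_left
  · exact le_trans (le_iSup₂_of_le ν h le_rfl) le_sup_right

/-- The spectral projection `P_μ` onto the generalized eigenspace of `μ`, along the sum of the
other generalized eigenspaces. -/
def spectralProj {V : Type*} [AddCommGroup V] [Module ℂ V] [FiniteDimensional ℂ V]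
    (T : Module.End ℂ V) (μ : ℂ) : Module.End ℂ V :=
  Submodule.projection _ _ (isCompl_maxGenEigenspace T μ)

/-- The asymptotic part `T_φ = ∑_{|μ| = 1} μ P_μ`, the sum running over the eigenvalues `μ` of `T`
of modulus one. -/
def peripheral {V : Type*} [AddCommGroup V] [Module ℂ V] [FiniteDimensional ℂ V]
    (T : Module.End ℂ V) : Module.End ℂ V :=
  ∑ μ ∈ (Module.End.finite_spectrum T).toFinset.filter (fun μ : ℂ => ‖μ‖ = 1),
    μ • spectralProj T μ

/-- The trace norm `‖X‖₁ = tr √(X† X)`. -/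
def traceNorm {ι : Type*} [Fintype ι] [DecidableEq ι] (X : Matrix ι ι ℂ) : ℝ :=
  (CFC.sqrt (Xᴴ * X)).trace.re

/-- The trace distance `‖ρ - σ‖₁ / 2`. -/
def traceDist {ι : Type*} [Fintype ι] [DecidableEq ι] (ρ σ : Matrix ι ι ℂ) : ℝ :=
  (1 / 2) * traceNorm (ρ - σ)

/-- The tensor product `A₁ ⊗ ⋯ ⊗ Aₙ`, as a matrix indexed by `n`-tuples of indices. -/
def tensorMatrix {ι : Type*} {n : ℕ} (A : Fin n → Matrix ι ι ℂ) :
    Matrix (Fin n → ι) (Fin n → ι) ℂ :=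
  Matrix.of fun f g => ∏ i, A i (f i) (g i)

/-- The tensor power `T^{⊗n}`: the linear map which sends each matrix unit
`E_{k₁ l₁} ⊗ ⋯ ⊗ E_{kₙ lₙ}` to `T(E_{k₁ l₁}) ⊗ ⋯ ⊗ T(E_{kₙ lₙ})`. -/
def tensorPow {ι : Type*} [Fintype ι] [DecidableEq ι] (n : ℕ)
    (T : Module.End ℂ (Matrix ι ι ℂ)) :
    Module.End ℂ (Matrix (Fin n → ι) (Fin n → ι) ℂ) :=
  (Matrix.stdBasis ℂ (Fin n → ι) (Fin n → ι)).constr ℂ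
    fun kl => tensorMatrix fun i => T (Matrix.single (kl.1 i) (kl.2 i) 1)

/-- The fully separable states: convex combinations of product states `ρ₁ ⊗ ⋯ ⊗ ρₙ`. -/
def separableStates (ι : Type*) [Fintype ι] (n : ℕ) :
    Set (Matrix (Fin n → ι) (Fin n → ι) ℂ) :=
  convexHull ℝ {X | ∃ ρ : Fin n → Matrix ι ι ℂ, (∀ i, IsState (ρ i)) ∧ X = tensorMatrix ρ}

/-- The trace-norm contraction of `T^{⊗n}` restricted to fully separable inputs. -/
def sepContraction {ι : Type*} [Fintype ι] [DecidableEq ι] (n : ℕ)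
    (T : Module.End ℂ (Matrix ι ι ℂ)) : ℝ :=
  sSup ((fun ρ => traceDist (tensorPow n T ρ) (tensorPow n (peripheral T) ρ)) ''
    separableStates ι n)

/-- A sequence `η n t` of contraction profiles exhibits a cutoff at the times `t_n`. -/
def HasCutoff (η : ℕ → ℝ → ℝ) (τ : ℕ → ℝ) : Prop :=
  ∀ c : ℝ, 0 < c →
    (c < 1 → Filter.Tendsto (fun n => η n (c * τ n)) Filter.atTop (nhds 1)) ∧
    (1 < c → Filter.Tendsto (fun n => η n (c * τ n)) Filter.atTop (nhds 0))

end QuantumCutoff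

end

noncomputable section

open scoped ComplexOrder MatrixOrder Matrix

namespace QuantumCutoff

/-! ### Trace inequalities and the variational formula for the trace distance -/

section TraceDistance

variable {ι : Type*} [Fintype ι]

/-! For a primitive semigroup with stationary state σ the asymptotic part is X ↦ tr(X) σ
(`peripheral_apply`), so the question is how well n evolved particles can be told from σ^{⊗n}. Trace
distance is the best bias tr(E(ρ − τ)) of an effect 0 ≤ E ≤ 1.

Above the cutoff: for fixed E the bias is linear in the input, so product inputs suffice. It is at
most the square root of the χ²-divergence, and 1 + χ² is multiplicative over tensor factors. Each
factor has χ² = O(e^{-2at}) for every a below the gap, so the bias is at most √(exp(n·O(e^{-2at})) −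
1). Here n e^{-2at} → 0 when c > 1 and a is close enough to the gap. Working with a below the gap
absorbs the polynomial factors of Jordan blocks.

Below the cutoff: a left eigenvector of L whose eigenvalue has real part minus the gap gives a
one-particle observable of bounded second moment, with mean 0 in σ and mean m e^{-gap·t} in T_t(ρ)
for a suitable ρ (`exists_observable_eq`). Summed over n copies, the means differ by n m e^{-gap·t}
while the variances are O(n). A Chebyshev argument (`one_sub_le_traceDist_tensorMatrix`) bounds the
error by a constant times 1/(n e^{-2·gap·t}) = n^{c-1} → 0. -/

theorem re_trace_mul_nonneg {A B : Matrix ι ι ℂ} (hA : A.PosSemidef) (hB : B.PosSemidef) :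
    0 ≤ (A * B).trace.re := by
  classical
  obtain ⟨C, rfl⟩ := CStarAlgebra.nonneg_iff_eq_star_mul_self.mp hA.nonneg
  rw [Matrix.mul_assoc, Matrix.trace_mul_comm, Matrix.star_eq_conjTranspose]
  exact (Complex.nonneg_iff.mp (hB.mul_mul_conjTranspose_same C).trace_nonneg).1

theorem re_trace_mul_le_re_trace_mul {A B C : Matrix ι ι ℂ} (hAB : A ≤ B) (hC : C.PosSemidef) :
    (A * C).trace.re ≤ (B * C).trace.re := by
  have h := re_trace_mul_nonneg (Matrix.le_iff.mp hAB) hC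
  rw [Matrix.sub_mul, Matrix.trace_sub, Complex.sub_re] at h
  linarith

variable [DecidableEq ι]

theorem traceNorm_eq_re_trace_abs (X : Matrix ι ι ℂ) : traceNorm X = (CFC.abs X).trace.re := rfl

/-- Every effect `0 ≤ E ≤ 1` bounds the trace distance from below. -/
theorem re_trace_effect_mul_le {E X : Matrix ι ι ℂ} (h0 : 0 ≤ E) (h1 : E ≤ 1)
    (hX : IsSelfAdjoint X) (htr : X.trace = 0) : (E * X).trace.re ≤ (1 / 2) * traceNorm X := by
  have hp : (CFC.abs X + X).PosSemidef := by
    rw [CFC.abs_add_self X hX, two_smul]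
    exact (Matrix.nonneg_iff_posSemidef.mp (add_nonneg (CFC.posPart_nonneg X)
      (CFC.posPart_nonneg X)))
  have hn : (CFC.abs X - X).PosSemidef := by
    rw [CFC.abs_sub_self X hX, two_smul]
    exact (Matrix.nonneg_iff_posSemidef.mp (add_nonneg (CFC.negPart_nonneg X)
      (CFC.negPart_nonneg X)))
  -- Subtracting `h3` from `h2` cancels tr(E|X|) and leaves 2 tr(EX) ≤ tr|X|, as tr X = 0.
  have h2 := re_trace_mul_le_re_trace_mul h1 hp
  have h3 := re_trace_mul_nonneg (Matrix.nonneg_iff_posSemidef.mp h0) hn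
  simp only [Matrix.mul_add, Matrix.mul_sub, Matrix.one_mul, Matrix.trace_add, Matrix.trace_sub,
    Complex.add_re, Complex.sub_re, htr, Complex.zero_re] at h2 h3
  rw [traceNorm_eq_re_trace_abs]
  linarith

/-- The trace distance is attained at an effect. -/
theorem exists_effect_eq_traceNorm {X : Matrix ι ι ℂ} (hX : IsSelfAdjoint X)
    (htr : X.trace = 0) :
    ∃ E : Matrix ι ι ℂ, 0 ≤ E ∧ E ≤ 1 ∧ (1 / 2) * traceNorm X = (E * X).trace.re := by
  have hc (f : ℝ → ℝ) : ContinuousOn f (spectrum ℝ X) := X.finite_real_spectrum.continuousOn f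
  -- The optimal effect is the spectral projection onto the positive part of X, because 2 f(x) x =
  -- |x| + x.
  let f : ℝ → ℝ := fun x => if 0 < x then 1 else 0
  refine ⟨cfc f X, cfc_nonneg fun x _ => ?_, cfc_le_one f X fun x _ => ?_, ?_⟩
  · simp only [f]; split_ifs <;> norm_num
  · simp only [f]; split_ifs <;> norm_num
  · have h : 2 • (cfc f X * X) = CFC.abs X + X := by
      rw [CFC.abs_eq_cfc_norm X hX]
      nth_rw 2 [← cfc_id' ℝ X hX]
      nth_rw 4 [← cfc_id' ℝ X hX]
      rw [← cfc_mul f _ X (hc _) (hc _), ← cfc_add X _ _ (hc _) (hc _), two_smul,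
        ← cfc_add X _ _ (hc _) (hc _)]
      refine cfc_congr fun x _ => ?_
      simp only [f, Real.norm_eq_abs]
      split_ifs with h
      · rw [abs_of_pos h]; ring
      · rw [abs_of_nonpos (not_lt.mp h)]; ring
    have h' := congrArg (fun Y : Matrix ι ι ℂ => Y.trace.re) h
    simp only [two_smul, Matrix.trace_add, Complex.add_re, htr, Complex.zero_re] at h'
    rw [traceNorm_eq_re_trace_abs]
    linarith

theorem re_trace_effect_mul_le_one {E ρ : Matrix ι ι ℂ} (h1 : E ≤ 1) (hρ : IsState ρ) :
    (E * ρ).trace.re ≤ 1 := by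
  simpa [hρ.2] using re_trace_mul_le_re_trace_mul h1 hρ.1

theorem traceDist_le_one {ρ τ : Matrix ι ι ℂ} (hρ : IsState ρ) (hτ : IsState τ) :
    traceDist ρ τ ≤ 1 := by
  obtain ⟨E, h0, h1, h⟩ := exists_effect_eq_traceNorm (X := ρ - τ)
    (hρ.1.isHermitian.sub hτ.1.isHermitian) (by simp [hρ.2, hτ.2])
  rw [traceDist, h, Matrix.mul_sub, Matrix.trace_sub, Complex.sub_re]
  linarith [re_trace_effect_mul_le_one h1 hρ,
    re_trace_mul_nonneg (Matrix.nonneg_iff_posSemidef.mp h0) hτ.1]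

theorem traceNorm_nonneg (X : Matrix ι ι ℂ) : 0 ≤ traceNorm X := by
  have h := (Matrix.nonneg_iff_posSemidef.mp (CFC.abs_nonneg X)).trace_nonneg
  exact (Complex.nonneg_iff.mp h).1

/-- 1 − E² = (1−E)E(1−E) + E(1−E)E + (1−E), a sum of positive terms. -/
theorem effect_sq_le_one {E : Matrix ι ι ℂ} (h0 : 0 ≤ E) (h1 : E ≤ 1) : E * E ≤ 1 := by
  have hE : IsSelfAdjoint E := IsSelfAdjoint.of_nonneg h0
  have hE' : Eᴴ = E := hE
  have hI : Matrix.PosSemidef (1 - E) := Matrix.le_iff.mp h1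
  have h2 := (Matrix.nonneg_iff_posSemidef.mp h0).conjTranspose_mul_mul_same (1 - E)
  have h3 := hI.conjTranspose_mul_mul_same E
  have h4 := (h2.add h3).add hI
  rw [Matrix.le_iff]
  convert h4 using 1
  rw [Matrix.conjTranspose_sub, hE', Matrix.conjTranspose_one]
  noncomm_ring

/-- The `χ²` bound on how well an effect distinguishes two states. -/
theorem re_trace_effect_mul_sub_le_sqrt {E X τ τ' : Matrix ι ι ℂ} (h0 : 0 ≤ E) (h1 : E ≤ 1)
    (hX : IsSelfAdjoint X) (hτ : IsState τ) (hττ' : τ * τ' = 1) :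
    (E * X).trace.re ≤ Real.sqrt (X * τ' * X).trace.re := by
  have hX' : Xᴴ = X := hX
  have hE' : Eᴴ = E := IsSelfAdjoint.of_nonneg h0
  have hτH : τᴴ = τ := hτ.1.isHermitian
  have hτ'τ : τ' * τ = 1 := mul_eq_one_comm.mp hττ'
  have hτ'H : τ'ᴴ = τ' := by
    have h : τ'ᴴ * τ = 1 := by
      have := congrArg Matrix.conjTranspose hττ'
      rwa [Matrix.conjTranspose_mul, hτH, Matrix.conjTranspose_one] at this
    calc τ'ᴴ = τ'ᴴ * (τ * τ') := by rw [hττ', Matrix.mul_one]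
      _ = τ' := by rw [← Matrix.mul_assoc, h, Matrix.one_mul]
  have hEE : (E * τ * E).trace.re ≤ 1 := by
    rw [Matrix.trace_mul_comm, ← Matrix.mul_assoc]
    exact re_trace_effect_mul_le_one (effect_sq_le_one h0 h1) hτ
  -- Cauchy–Schwarz for the form tr(AτB†), applied to A = Xτ' and B = E. The choice k = χ gives the
  -- claim if χ > 0; if χ = 0, the choice k = tr(EX) rules out a positive bias.
  have key (k : ℝ) : 0 ≤ (X * τ' * X).trace.re - 2 * k * (E * X).trace.re +
      k ^ 2 * (E * τ * E).trace.re := by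
    have h := (hτ.1.mul_mul_conjTranspose_same (X * τ' - (k : ℂ) • E)).trace_nonneg
    have h := (Complex.nonneg_iff.mp h).1
    have e : (X * τ' - (k : ℂ) • E) * τ * (X * τ' - (k : ℂ) • E)ᴴ =
        X * τ' * X - (k : ℂ) • (X * E) - (k : ℂ) • (E * X) + (k : ℂ) • (k : ℂ) • (E * τ * E) := by
      have a1 : X * τ' * τ = X := by rw [Matrix.mul_assoc, hτ'τ, Matrix.mul_one]
      have a2 : E * τ * τ' * X = E * X := by
        rw [Matrix.mul_assoc E, hττ', Matrix.mul_one]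
      rw [Matrix.conjTranspose_sub, Matrix.conjTranspose_mul, Matrix.conjTranspose_smul, hX', hE',
        hτ'H, Matrix.sub_mul, a1, Matrix.mul_sub, Matrix.sub_mul, Matrix.sub_mul]
      simp only [Matrix.smul_mul, Matrix.mul_smul, a2, Complex.star_def, Complex.conj_ofReal,
        ← Matrix.mul_assoc]
      abel
    rw [e] at h
    simp only [Matrix.trace_add, Matrix.trace_sub, Matrix.trace_smul, smul_eq_mul, Complex.add_re,
      Complex.sub_re, Complex.re_ofReal_mul, Matrix.trace_mul_comm X E] at h
    linarith
  have hχ : 0 ≤ (X * τ' * X).trace.re := by simpa using key 0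
  set χ := Real.sqrt (X * τ' * X).trace.re with hχdef
  have hsq : χ ^ 2 = (X * τ' * X).trace.re := Real.sq_sqrt hχ
  rcases (Real.sqrt_nonneg (X * τ' * X).trace.re).eq_or_lt' with h | h
  · rw [← hχdef] at h
    by_contra! hlt
    rw [h] at hlt
    have := key (E * X).trace.re
    rw [← hsq, h] at this
    nlinarith [mul_pos hlt hlt]
  · rw [← hχdef] at h
    have := key χ
    rw [← hsq] at this
    have : χ * (E * X).trace.re ≤ χ * χ := by nlinarith [sq_nonneg χ]
    exact le_of_mul_le_mul_left this h

end TraceDistance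

/-! ### Tensor products of matrices -/

section Tensor

variable {ι : Type*} {n : ℕ}

theorem conjTranspose_tensorMatrix (A : Fin n → Matrix ι ι ℂ) :
    (tensorMatrix A)ᴴ = tensorMatrix fun i => (A i)ᴴ := by
  ext f g
  simp [tensorMatrix, Matrix.conjTranspose_apply]

theorem tensorMatrix_one [DecidableEq ι] :
    tensorMatrix (fun _ : Fin n => (1 : Matrix ι ι ℂ)) = 1 := by
  ext f g
  simp only [tensorMatrix, Matrix.of_apply, Matrix.one_apply]
  rw [Finset.prod_ite_zero]
  simp [funext_iff]

variable [Fintype ι]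

theorem tensorMatrix_mul (A B : Fin n → Matrix ι ι ℂ) :
    tensorMatrix A * tensorMatrix B = tensorMatrix fun i => A i * B i := by
  classical
  ext f g
  simp only [tensorMatrix, Matrix.mul_apply, Matrix.of_apply, ← Finset.prod_mul_distrib]
  rw [Finset.prod_univ_sum, Fintype.piFinset_univ]

theorem trace_tensorMatrix (A : Fin n → Matrix ι ι ℂ) :
    (tensorMatrix A).trace = ∏ i, (A i).trace := by
  classical
  simp only [Matrix.trace, Matrix.diag, tensorMatrix, Matrix.of_apply]
  rw [Finset.prod_univ_sum, Fintype.piFinset_univ]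

theorem posSemidef_tensorMatrix {A : Fin n → Matrix ι ι ℂ} (hA : ∀ i, (A i).PosSemidef) :
    (tensorMatrix A).PosSemidef := by
  classical
  choose B hB using fun i => CStarAlgebra.nonneg_iff_eq_star_mul_self.mp (hA i).nonneg
  have h : tensorMatrix A = (tensorMatrix B)ᴴ * tensorMatrix B := by
    rw [conjTranspose_tensorMatrix, tensorMatrix_mul]
    exact congrArg tensorMatrix (funext hB)
  rw [h]
  exact Matrix.posSemidef_conjTranspose_mul_self _

theorem isState_tensorMatrix {ρ : Fin n → Matrix ι ι ℂ} (hρ : ∀ i, IsState (ρ i)) :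
    IsState (tensorMatrix ρ) :=
  ⟨posSemidef_tensorMatrix fun i => (hρ i).1, by simp [trace_tensorMatrix, (hρ _).2]⟩

theorem end_apply_eq_sum [DecidableEq ι] (T : Module.End ℂ (Matrix ι ι ℂ)) (B : Matrix ι ι ℂ)
    (x y : ι) : T B x y = ∑ kl : ι × ι, B kl.1 kl.2 * T (Matrix.single kl.1 kl.2 1) x y := by
  conv_lhs => rw [Matrix.matrix_eq_sum_single B]
  simp only [map_sum, Matrix.sum_apply, Fintype.sum_prod_type]
  refine Finset.sum_congr rfl fun i _ => Finset.sum_congr rfl fun j _ => ?_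
  rw [← mul_one (B i j), ← smul_eq_mul, ← Matrix.smul_single, map_smul, Matrix.smul_apply,
    smul_eq_mul, smul_eq_mul, mul_one]

/-- The definition fixes only the images of matrix units; expanding every T(A i) in them and
multiplying out the product of sums gives all product matrices. -/
theorem tensorPow_tensorMatrix [DecidableEq ι] (T : Module.End ℂ (Matrix ι ι ℂ))
    (A : Fin n → Matrix ι ι ℂ) :
    tensorPow n T (tensorMatrix A) = tensorMatrix fun i => T (A i) := by
  ext f g
  simp only [tensorPow, Module.Basis.constr_apply_fintype, Matrix.sum_apply, Matrix.smul_apply,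
    tensorMatrix, Matrix.of_apply, end_apply_eq_sum T (A _), smul_eq_mul]
  rw [Finset.prod_univ_sum, Fintype.piFinset_univ]
  refine Fintype.sum_equiv (Equiv.arrowProdEquivProdArrow (Fin n) (fun _ => ι) (fun _ => ι)).symm
    _ _ fun kl => ?_
  rw [Finset.prod_mul_distrib]
  simp [Module.Basis.equivFun_apply, Matrix.stdBasis, Equiv.arrowProdEquivProdArrow]

end Tensor

/-! ### Sums of one-particle observables and their variances. -/

section AdditiveObservable

variable {ι : Type*} [DecidableEq ι] {n : ℕ}

/-- The sum over all tensor factors of a one-particle observable. -/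
def additiveObservable (n : ℕ) (H : Matrix ι ι ℂ) : Matrix (Fin n → ι) (Fin n → ι) ℂ :=
  ∑ i, tensorMatrix (Function.update (fun _ => 1) i H)

theorem isSelfAdjoint_additiveObservable {H : Matrix ι ι ℂ} (hH : IsSelfAdjoint H) :
    IsSelfAdjoint (additiveObservable n H) := by
  have hH' : Hᴴ = H := hH
  change (additiveObservable n H)ᴴ = _
  rw [additiveObservable, Matrix.conjTranspose_sum]
  refine Finset.sum_congr rfl fun i _ => ?_
  rw [conjTranspose_tensorMatrix]
  congr 1
  ext1 j
  by_cases h : j = i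
  · subst h; simpa using hH'
  · simp [Function.update_of_ne h]

theorem tensorMatrix_update_sub_smul_one (i : Fin n) (H : Matrix ι ι ℂ) (m : ℂ) :
    tensorMatrix (Function.update (fun _ => 1) i (H - m • (1 : Matrix ι ι ℂ))) =
      tensorMatrix (Function.update (fun _ => 1) i H) - m • 1 := by
  rw [← tensorMatrix_one]
  ext f g
  simp only [tensorMatrix, Matrix.of_apply, Matrix.sub_apply, Matrix.smul_apply, smul_eq_mul]
  simp only [← Finset.mul_prod_erase _ _ (Finset.mem_univ i), Function.update_self]
  have h (K : Matrix ι ι ℂ) : ∏ j ∈ Finset.univ.erase i,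
      Function.update (fun _ : Fin n => (1 : Matrix ι ι ℂ)) i K j (f j) (g j) =
      ∏ j ∈ Finset.univ.erase i, (1 : Matrix ι ι ℂ) (f j) (g j) :=
    Finset.prod_congr rfl fun j hj => by rw [Function.update_of_ne (Finset.ne_of_mem_erase hj)]
  rw [h, h]
  simp only [Matrix.sub_apply, Matrix.smul_apply, smul_eq_mul]
  ring

theorem additiveObservable_sub_smul_one (H : Matrix ι ι ℂ) (m : ℂ) :
    additiveObservable n (H - m • (1 : Matrix ι ι ℂ)) =
      additiveObservable n H - ((n : ℂ) * m) • 1 := by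
  simp [additiveObservable, tensorMatrix_update_sub_smul_one, Finset.sum_sub_distrib, mul_smul,
    ← Nat.cast_smul_eq_nsmul ℂ]

/-- Centred independent observables: the variances add up. -/
theorem trace_additiveObservable_sq [Fintype ι] {H ρ : Matrix ι ι ℂ} (hρ : ρ.trace = 1)
    (hH : (H * ρ).trace = 0) :
    (additiveObservable n H * additiveObservable n H * tensorMatrix fun _ : Fin n => ρ).trace =
      n * (H * H * ρ).trace := by
  simp only [additiveObservable, Finset.sum_mul, Finset.mul_sum, Matrix.trace_sum,
    tensorMatrix_mul, trace_tensorMatrix]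
  -- Cross terms vanish: for i ≠ j the i-th factor is tr(Hρ) = 0.
  have h (i j : Fin n) : ∏ k, (Function.update (fun _ => (1 : Matrix ι ι ℂ)) i H k *
      Function.update (fun _ => (1 : Matrix ι ι ℂ)) j H k * ρ).trace =
      if i = j then (H * H * ρ).trace else 0 := by
    split_ifs with hij
    · subst hij
      rw [Finset.prod_eq_single i]
      · simp
      · intro k _ hk; simp [Function.update_of_ne hk, hρ]
      · simp
    · refine Finset.prod_eq_zero (Finset.mem_univ i) ?_
      simp [Function.update_of_ne hij, hH]
  simp [h]

end AdditiveObservable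

/-! ### Distinguishing product states -/

section Distinguish

variable {ι : Type*} [Fintype ι] [DecidableEq ι]

/-- The `χ²`-divergence of `ρ` from `σ`. -/
def chiSq (ρ σ : Matrix ι ι ℂ) : ℝ := ((ρ - σ) * σ⁻¹ * (ρ - σ)).trace.re

/-- tr(ρσ⁻¹ρ) is multiplicative under tensor products, so this form is what lets χ² tensorize. -/
theorem trace_mul_inv_mul_eq {ρ σ : Matrix ι ι ℂ} (hρ : IsState ρ) (hσ : IsState σ)
    (hpos : σ.PosDef) : (ρ * σ⁻¹ * ρ).trace = ((1 + chiSq ρ σ : ℝ) : ℂ) := by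
  have hdet : IsUnit σ.det := (Matrix.isUnit_iff_isUnit_det σ).mp hpos.isUnit
  have hH : (ρ - σ)ᴴ = ρ - σ := hρ.1.isHermitian.sub hσ.1.isHermitian
  have hnn := (hpos.inv.posSemidef.mul_mul_conjTranspose_same (ρ - σ)).trace_nonneg
  rw [hH] at hnn
  have hreal : ((ρ - σ) * σ⁻¹ * (ρ - σ)).trace = (chiSq ρ σ : ℂ) :=
    Complex.ext rfl (by simpa using (Complex.nonneg_iff.mp hnn).2.symm)
  have e : (ρ - σ) * σ⁻¹ * (ρ - σ) = ρ * σ⁻¹ * ρ - ρ - ρ + σ := by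
    rw [Matrix.sub_mul, Matrix.mul_nonsing_inv σ hdet, Matrix.sub_mul, Matrix.one_mul,
      Matrix.mul_sub, Matrix.mul_assoc ρ σ⁻¹ σ, Matrix.nonsing_inv_mul σ hdet, Matrix.mul_one]
    abel
  rw [e] at hreal
  simp only [Matrix.trace_add, Matrix.trace_sub, hρ.2, hσ.2] at hreal
  push_cast
  linear_combination hreal

theorem chiSq_nonneg {ρ σ : Matrix ι ι ℂ} (hρ : IsState ρ) (hσ : IsState σ)
    (hpos : σ.PosDef) : 0 ≤ chiSq ρ σ := by
  have hH : (ρ - σ)ᴴ = ρ - σ := hρ.1.isHermitian.sub hσ.1.isHermitian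
  have hnn := (hpos.inv.posSemidef.mul_mul_conjTranspose_same (ρ - σ)).trace_nonneg
  rw [hH] at hnn
  exact (Complex.nonneg_iff.mp hnn).1

/-- Product states whose factors are `χ²`-close are hard to distinguish. -/
theorem re_trace_effect_mul_tensorMatrix_sub_le {n : ℕ} {σ : Matrix ι ι ℂ} (hσ : IsState σ)
    (hpos : σ.PosDef) {ρ : Fin n → Matrix ι ι ℂ} (hρ : ∀ i, IsState (ρ i)) {δ : ℝ}
    (hδ : ∀ i, chiSq (ρ i) σ ≤ δ) {E : Matrix (Fin n → ι) (Fin n → ι) ℂ} (h0 : 0 ≤ E)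
    (h1 : E ≤ 1) :
    (E * (tensorMatrix ρ - tensorMatrix fun _ => σ)).trace.re ≤
      Real.sqrt (Real.exp (n * δ) - 1) := by
  have hdet : IsUnit σ.det := (Matrix.isUnit_iff_isUnit_det σ).mp hpos.isUnit
  have hinv : (tensorMatrix fun _ : Fin n => σ) * (tensorMatrix fun _ => σ⁻¹) = 1 := by
    rw [tensorMatrix_mul, Matrix.mul_nonsing_inv σ hdet, tensorMatrix_one]
  have hinv' : (tensorMatrix fun _ : Fin n => σ⁻¹) * (tensorMatrix fun _ => σ) = 1 :=
    mul_eq_one_comm.mp hinv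
  have hR := isState_tensorMatrix hρ
  have hS := isState_tensorMatrix fun _ : Fin n => hσ
  refine (re_trace_effect_mul_sub_le_sqrt h0 h1 (hR.1.isHermitian.sub hS.1.isHermitian) hS
    hinv).trans (Real.sqrt_le_sqrt ?_)
  -- The trace of the right side is ∏(1 + χ²(ρ i, σ)) − 1.
  have e : (tensorMatrix ρ - tensorMatrix fun _ => σ) * (tensorMatrix fun _ => σ⁻¹) *
      (tensorMatrix ρ - tensorMatrix fun _ => σ) =
      (tensorMatrix fun i => ρ i * σ⁻¹ * ρ i) - tensorMatrix ρ - tensorMatrix ρ +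
        tensorMatrix fun _ => σ := by
    rw [Matrix.sub_mul, hinv, Matrix.sub_mul, Matrix.one_mul, Matrix.mul_sub,
      Matrix.mul_assoc (tensorMatrix ρ) _ (tensorMatrix fun _ => σ), hinv', Matrix.mul_one,
      tensorMatrix_mul, tensorMatrix_mul]
    abel
  rw [e]
  simp only [Matrix.trace_add, Matrix.trace_sub, hR.2, hS.2, trace_tensorMatrix,
    trace_mul_inv_mul_eq (hρ _) hσ hpos]
  rw [← Complex.ofReal_prod]
  simp only [Complex.add_re, Complex.sub_re, Complex.ofReal_re, Complex.one_re]
  have hp : ∏ i, (1 + chiSq (ρ i) σ) ≤ Real.exp (n * δ) :=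
    calc ∏ i, (1 + chiSq (ρ i) σ) ≤ ∏ _i : Fin n, Real.exp δ :=
          Finset.prod_le_prod (fun i _ => by linarith [chiSq_nonneg (hρ i) hσ hpos])
            fun i _ => by linarith [hδ i, Real.add_one_le_exp δ]
      _ = Real.exp (n * δ) := by simp [Real.exp_nat_mul]
  linarith

/-- A quantum Chebyshev inequality: an observable whose values are concentrated near `0` in the
state `τ` and near `2 * g` in the state `ρ` distinguishes the two states. -/
theorem one_sub_le_traceDist {ρ τ A : Matrix ι ι ℂ} (hρ : IsState ρ) (hτ : IsState τ)
    (hA : IsSelfAdjoint A) {g : ℝ} (hg : 0 < g) :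
    1 - ((A * A * τ).trace.re +
      ((A - ((2 * g : ℝ) : ℂ) • 1) * (A - ((2 * g : ℝ) : ℂ) • 1) * ρ).trace.re) / (2 * g ^ 2) ≤
      traceDist ρ τ := by
  have hc (f : ℝ → ℝ) : ContinuousOn f (spectrum ℝ A) := A.finite_real_spectrum.continuousOn f
  -- A soft threshold between 0 and 2g. Its denominator is at least 2g², so f ≤ x²/(2g²) and 1 − f ≤
  -- (x−2g)²/(2g²): both error probabilities are bounded by second moments.
  let f : ℝ → ℝ := fun x => x ^ 2 / (x ^ 2 + (x - 2 * g) ^ 2)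
  have hden (x : ℝ) : 2 * g ^ 2 ≤ x ^ 2 + (x - 2 * g) ^ 2 := by nlinarith [sq_nonneg (x - g)]
  have hg2 : 0 < 2 * g ^ 2 := by positivity
  have h0 : 0 ≤ cfc f A := cfc_nonneg fun x _ => by positivity
  have h1 : cfc f A ≤ 1 := cfc_le_one f A fun x _ =>
    div_le_one_of_le₀ (by nlinarith [sq_nonneg (x - 2 * g)]) (by positivity)
  have hAA : A * A = cfc (fun x : ℝ => x * x) A := by
    rw [cfc_mul (fun x : ℝ => x) (fun x => x) A (hc _) (hc _), cfc_id' ℝ A hA]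
  have hB : A - ((2 * g : ℝ) : ℂ) • (1 : Matrix ι ι ℂ) = cfc (fun x : ℝ => x - 2 * g) A := by
    rw [cfc_sub (a := A) (fun x : ℝ => x) (fun _ => 2 * g) (hc _) (hc _), cfc_id' ℝ A hA,
      cfc_const (2 * g) A hA, Algebra.algebraMap_eq_smul_one]
    congr 1
  have hBB : (A - ((2 * g : ℝ) : ℂ) • 1) * (A - ((2 * g : ℝ) : ℂ) • 1) =
      cfc (fun x : ℝ => (x - 2 * g) * (x - 2 * g)) A := by
    rw [hB, ← cfc_mul _ _ A (hc _) (hc _)]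
  have hτ' : (2 * g ^ 2) * (cfc f A * τ).trace.re ≤ (A * A * τ).trace.re := by
    have h : (2 * g ^ 2) • cfc f A ≤ A * A := by
      rw [hAA, ← cfc_smul _ f A (hc _)]
      refine cfc_mono (fun x _ => ?_) (hc _) (hc _)
      have hd := hg2.trans_le (hden x)
      simp only [f, smul_eq_mul]
      rw [← mul_div_assoc, div_le_iff₀ hd]
      nlinarith [mul_le_mul_of_nonneg_right (hden x) (sq_nonneg x)]
    simpa only [Matrix.smul_mul, Matrix.trace_smul, Complex.smul_re, smul_eq_mul] using
      re_trace_mul_le_re_trace_mul h hτ.1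
  have hρ' : (2 * g ^ 2) * ((1 - cfc f A) * ρ).trace.re ≤
      ((A - ((2 * g : ℝ) : ℂ) • 1) * (A - ((2 * g : ℝ) : ℂ) • 1) * ρ).trace.re := by
    have h : (2 * g ^ 2) • (1 - cfc f A) ≤
        (A - ((2 * g : ℝ) : ℂ) • 1) * (A - ((2 * g : ℝ) : ℂ) • 1) := by
      rw [hBB, ← cfc_one ℝ A hA, ← cfc_sub (a := A) _ _ (hc _) (hc _), ← cfc_smul _ _ A (hc _)]
      refine cfc_mono (fun x _ => ?_) (hc _) (hc _)
      have hd := hg2.trans_le (hden x)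
      have e : 1 - f x = (x - 2 * g) ^ 2 / (x ^ 2 + (x - 2 * g) ^ 2) := by
        simp only [f]; field_simp; ring
      simp only [smul_eq_mul, Pi.one_apply]
      rw [e, ← mul_div_assoc, div_le_iff₀ hd]
      nlinarith [mul_le_mul_of_nonneg_right (hden x) (sq_nonneg (x - 2 * g))]
    simpa only [Matrix.smul_mul, Matrix.trace_smul, Complex.smul_re, smul_eq_mul] using
      re_trace_mul_le_re_trace_mul h hρ.1
  have hlow := re_trace_effect_mul_le h0 h1 (hρ.1.isHermitian.sub hτ.1.isHermitian)
    (by simp [hρ.2, hτ.2] : (ρ - τ).trace = 0)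
  rw [Matrix.sub_mul, Matrix.one_mul, Matrix.trace_sub, hρ.2, Complex.sub_re,
    Complex.one_re] at hρ'
  rw [Matrix.mul_sub, Matrix.trace_sub, Complex.sub_re] at hlow
  refine le_trans ?_ hlow
  rw [sub_le_comm, le_div_iff₀ hg2]
  linarith

/-- Many copies of two states with different expectations of an observable are easy to
distinguish. -/
theorem one_sub_le_traceDist_tensorMatrix {n : ℕ} (hn : 0 < n) {ρ σ H : Matrix ι ι ℂ}
    (hρ : IsState ρ) (hσ : IsState σ) (hH : IsSelfAdjoint H) {m K : ℝ} (hm : 0 < m)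
    (hHσ : (H * σ).trace = 0) (hHρ : (H * ρ).trace = m)
    (hKσ : (H * H * σ).trace.re ≤ K) (hKρ : (H * H * ρ).trace.re ≤ K) :
    1 - 4 * K / (n * m ^ 2) ≤
      traceDist (tensorMatrix fun _ : Fin n => ρ) (tensorMatrix fun _ => σ) := by
  have hn' : (0 : ℝ) < n := by exact_mod_cast hn
  refine le_trans ?_ (one_sub_le_traceDist (isState_tensorMatrix fun _ => hρ)
    (isState_tensorMatrix fun _ => hσ) (isSelfAdjoint_additiveObservable hH)
    -- With g = nm/2, the point 2g = nm is the mean of the summed observable in ρ^{⊗n}.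
    (show 0 < n * m / 2 by positivity))
  have e : additiveObservable n H - ((2 * (n * m / 2) : ℝ) : ℂ) • 1 =
      additiveObservable n (H - (m : ℂ) • (1 : Matrix ι ι ℂ)) := by
    rw [additiveObservable_sub_smul_one]
    congr 2
    push_cast
    ring
  have hc : ((H - (m : ℂ) • (1 : Matrix ι ι ℂ)) * ρ).trace = 0 := by
    simp [Matrix.sub_mul, hHρ, hρ.2]
  -- The variance is the second moment minus m².
  have hv : ((H - (m : ℂ) • (1 : Matrix ι ι ℂ)) * (H - (m : ℂ) • (1 : Matrix ι ι ℂ)) * ρ).trace.re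
      ≤ K := by
    have : (H - (m : ℂ) • (1 : Matrix ι ι ℂ)) * (H - (m : ℂ) • (1 : Matrix ι ι ℂ)) * ρ =
        H * H * ρ - (m : ℂ) • (H * ρ) - (m : ℂ) • ((H - (m : ℂ) • (1 : Matrix ι ι ℂ)) * ρ) := by
      simp only [Matrix.sub_mul, Matrix.mul_sub, Matrix.smul_mul, Matrix.mul_smul, Matrix.one_mul,
        Matrix.mul_one]
    rw [this]
    simp only [Matrix.trace_sub, Matrix.trace_smul, hc, hHρ, smul_eq_mul, mul_zero, sub_zero,
      Complex.sub_re, Complex.re_ofReal_mul, Complex.ofReal_re]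
    nlinarith
  rw [e, trace_additiveObservable_sq hσ.2 hHσ, trace_additiveObservable_sq hρ.2 hc]
  simp only [← Complex.ofReal_natCast, Complex.re_ofReal_mul]
  have hbound : (n * (H * H * σ).trace.re + n * ((H - (m : ℂ) • (1 : Matrix ι ι ℂ)) *
      (H - (m : ℂ) • (1 : Matrix ι ι ℂ)) * ρ).trace.re) / (2 * (n * m / 2) ^ 2) ≤
      (n * K + n * K) / (2 * (n * m / 2) ^ 2) := by gcongr
  have e2 : (n * K + n * K) / (2 * (n * m / 2) ^ 2) = 4 * K / (n * m ^ 2) := by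
    field_simp; ring
  linarith

end Distinguish

/-! ### The exponential of a linear map on matrices -/

section Exponential

variable {ι : Type*} [Fintype ι] [DecidableEq ι]

theorem matrix_hasSum_exp {m : Type*} [Fintype m] [DecidableEq m] (M : Matrix m m ℂ) :
    HasSum (fun k : ℕ => ((k.factorial : ℂ)⁻¹) • M ^ k) (NormedSpace.exp M) := by
  open scoped Matrix.Norms.Operator in
  exact NormedSpace.exp_series_hasSum_exp' (𝕂 := ℂ) M

theorem hasSum_expEnd (S : Module.End ℂ (Matrix ι ι ℂ)) (X : Matrix ι ι ℂ) :
    HasSum (fun k : ℕ => ((k.factorial : ℂ)⁻¹) • (S ^ k) X) (expEnd S X) := by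
  let b := Matrix.stdBasis ℂ ι ι
  let φ : Matrix (ι × ι) (ι × ι) ℂ →ₗ[ℂ] Matrix ι ι ℂ :=
    (LinearMap.applyₗ X).comp (Matrix.toLin b b).toLinearMap
  have hφ : Continuous φ := LinearMap.continuous_of_finiteDimensional φ
  have h := (matrix_hasSum_exp (LinearMap.toMatrix b b S)).map φ hφ
  have e (k : ℕ) : φ (((k.factorial : ℂ)⁻¹) • LinearMap.toMatrix b b S ^ k) =
      ((k.factorial : ℂ)⁻¹) • (S ^ k) X := by
    rw [map_smul]
    simp [φ, LinearMap.toMatrix_pow]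
  simp only [Function.comp_def, e] at h
  exact h

theorem expEnd_add_of_commute {S S' : Module.End ℂ (Matrix ι ι ℂ)} (h : Commute S S') :
    expEnd (S + S') = expEnd S * expEnd S' := by
  let b := Matrix.stdBasis ℂ ι ι
  have hc : Commute (LinearMap.toMatrix b b S) (LinearMap.toMatrix b b S') := by
    rw [Commute, SemiconjBy, ← LinearMap.toMatrix_mul, ← LinearMap.toMatrix_mul, h.eq]
  rw [expEnd, map_add, Matrix.exp_add_of_commute _ _ hc, Matrix.toLin_mul b b b]
  rfl

theorem expEnd_apply_of_apply_eq_smul {S : Module.End ℂ (Matrix ι ι ℂ)} {X : Matrix ι ι ℂ} {μ : ℂ}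
    (h : S X = μ • X) : expEnd S X = Complex.exp μ • X := by
  have hk (k : ℕ) : (S ^ k) X = μ ^ k • X := by
    induction k with
    | zero => simp
    | succ k ih => rw [pow_succ', Module.End.mul_apply, ih, map_smul, h, smul_smul, pow_succ]
  have h1 := hasSum_expEnd S X
  have h2 : HasSum (fun k : ℕ => ((k.factorial : ℂ)⁻¹) • (S ^ k) X) (Complex.exp μ • X) := by
    rw [Complex.exp_eq_exp_ℂ]
    have := (NormedSpace.exp_series_hasSum_exp' (𝕂 := ℂ) μ).smul_const X
    simpa only [hk, smul_smul, smul_eq_mul] using this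
  exact h1.unique h2

/-- The dual statement, for left eigenvectors; it gives the exact decay used in the lower bound. -/
theorem apply_expEnd_of_comp_eq_smul {S : Module.End ℂ (Matrix ι ι ℂ)}
    {l : Matrix ι ι ℂ →ₗ[ℂ] ℂ} {μ : ℂ} (h : ∀ X, l (S X) = μ * l X) (X : Matrix ι ι ℂ) :
    l (expEnd S X) = Complex.exp μ * l X := by
  have hk (k : ℕ) : l ((S ^ k) X) = μ ^ k * l X := by
    induction k with
    | zero => simp
    | succ k ih => rw [pow_succ', Module.End.mul_apply, h, ih, pow_succ]; ring
  have h1 := (hasSum_expEnd S X).map l (LinearMap.continuous_of_finiteDimensional l)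
  have h2 : HasSum (fun k : ℕ => l (((k.factorial : ℂ)⁻¹) • (S ^ k) X))
      (Complex.exp μ * l X) := by
    rw [Complex.exp_eq_exp_ℂ]
    have := (NormedSpace.exp_series_hasSum_exp' (𝕂 := ℂ) μ).mul_right (l X)
    simpa only [map_smul, hk, smul_eq_mul, mul_assoc] using this
  exact h1.unique h2

theorem expEnd_apply_of_pow_apply_eq_zero {S : Module.End ℂ (Matrix ι ι ℂ)} {X : Matrix ι ι ℂ}
    {K : ℕ} (h : (S ^ K) X = 0) :
    expEnd S X = ∑ k ∈ Finset.range K, ((k.factorial : ℂ)⁻¹) • (S ^ k) X := by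
  refine (hasSum_expEnd S X).unique (hasSum_sum_of_ne_finset_zero fun k hk => ?_)
  obtain ⟨m, rfl⟩ := Nat.exists_eq_add_of_le (not_lt.mp fun h => hk (Finset.mem_range.mpr h))
  rw [add_comm, pow_add, Module.End.mul_apply, h, map_zero, smul_zero]

theorem semigroup_commute (L : Module.End ℂ (Matrix ι ι ℂ)) (s t : ℝ) (X : Matrix ι ι ℂ) :
    semigroup L s (semigroup L t X) = semigroup L t (semigroup L s X) := by
  have hc (s t : ℝ) : Commute ((s : ℂ) • L) ((t : ℂ) • L) :=
    ((Commute.refl L).smul_left _).smul_right _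
  rw [← Module.End.mul_apply, ← Module.End.mul_apply, semigroup, semigroup,
    ← expEnd_add_of_commute (hc s t), ← expEnd_add_of_commute (hc t s), add_comm]

theorem semigroup_apply_of_apply_eq_smul {L : Module.End ℂ (Matrix ι ι ℂ)} {X : Matrix ι ι ℂ}
    {μ : ℂ} (h : L X = μ • X) (t : ℝ) : semigroup L t X = Complex.exp (t * μ) • X :=
  expEnd_apply_of_apply_eq_smul (by rw [LinearMap.smul_apply, h, smul_smul])

/-- tL is the sum of the commuting maps tμ and t(L − μ), and the exponential series of the latter
terminates on X. -/
theorem semigroup_apply_of_mem_maxGenEigenspace {L : Module.End ℂ (Matrix ι ι ℂ)}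
    {X : Matrix ι ι ℂ} {μ : ℂ} {K : ℕ} (h : ((L - μ • 1) ^ K) X = 0) (t : ℝ) :
    semigroup L t X = Complex.exp (t * μ) • ∑ k ∈ Finset.range K,
      ((t : ℂ) ^ k * (k.factorial : ℂ)⁻¹) • ((L - μ • 1) ^ k) X := by
  have hc : Commute (((t : ℂ) * μ) • (1 : Module.End ℂ (Matrix ι ι ℂ)))
      ((t : ℂ) • (L - μ • 1)) := (Commute.one_left _).smul_left _
  have e : (t : ℂ) • L = ((t : ℂ) * μ) • 1 + (t : ℂ) • (L - μ • 1) := by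
    rw [smul_sub, smul_smul]; abel
  rw [semigroup, e, expEnd_add_of_commute hc, Module.End.mul_apply,
    expEnd_apply_of_apply_eq_smul (S := ((t : ℂ) * μ) • 1) (μ := t * μ) (by simp)]
  congr 1
  have h' : (((t : ℂ) • (L - μ • 1)) ^ K) X = 0 := by
    rw [smul_pow, LinearMap.smul_apply, h, smul_zero]
  rw [expEnd_apply_of_pow_apply_eq_zero h']
  refine Finset.sum_congr rfl fun k _ => ?_
  rw [smul_pow, LinearMap.smul_apply, smul_smul, mul_comm]

open Asymptotics Filter in
/-- Generalized eigenvectors decay at every rate smaller than that of their eigenvalue. -/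
theorem isBigO_semigroup_of_mem_maxGenEigenspace {L : Module.End ℂ (Matrix ι ι ℂ)}
    {X : Matrix ι ι ℂ} {μ : ℂ} (hX : X ∈ L.maxGenEigenspace μ) {a : ℝ} (ha : μ.re < -a) (i j : ι) :
    (fun t : ℝ => semigroup L t X i j) =O[atTop] fun t => Real.exp (-a * t) := by
  obtain ⟨K, hK⟩ := (Module.End.mem_maxGenEigenspace L μ X).mp hX
  simp only [semigroup_apply_of_mem_maxGenEigenspace hK, Finset.smul_sum, Matrix.sum_apply]
  refine IsBigO.fun_sum fun k _ => ?_
  -- The slack −a − Re μ > 0 absorbs the polynomial factor.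
  have h1 : (fun t : ℝ => t ^ k) =O[atTop] fun t => Real.exp ((-a - μ.re) * t) :=
    (isLittleO_pow_exp_pos_mul_atTop k (by linarith)).isBigO
  have h2 : (fun t : ℝ => Complex.exp (t * μ)) =O[atTop] fun t : ℝ => Real.exp (μ.re * t) :=
    IsBigO.of_norm_le fun t => by
      rw [Complex.norm_exp]; simp [mul_comm]
  have h3 : (fun t : ℝ => (t : ℂ) ^ k) =O[atTop] fun t : ℝ => t ^ k :=
    IsBigO.of_bound 1 (Eventually.of_forall fun t => by simp)
  have h4 := (h2.mul (h3.trans h1)).const_mul_left ((k.factorial : ℂ)⁻¹ * ((L - μ • 1) ^ k) X i j)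
  refine h4.congr (fun t => ?_) fun t => ?_
  · simp only [Matrix.smul_apply, smul_eq_mul]; ring
  · rw [← Real.exp_add]; ring_nf

end Exponential

/-! ### States and channels -/

section Channel

variable {ι : Type*} [Fintype ι]

theorem IsChannel.posSemidef_apply {T : Module.End ℂ (Matrix ι ι ℂ)} (hT : IsChannel T)
    {X : Matrix ι ι ℂ} (hX : X.PosSemidef) : (T X).PosSemidef := by
  have h := hT.completelyPositive 1 _ (hX.submatrix (Prod.snd : Fin 1 × ι → ι))
  exact h.submatrix fun i => ((0 : Fin 1), i)

theorem IsChannel.isState_apply {T : Module.End ℂ (Matrix ι ι ℂ)} (hT : IsChannel T)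
    {ρ : Matrix ι ι ℂ} (hρ : IsState ρ) : IsState (T ρ) :=
  ⟨hT.posSemidef_apply hρ.1, by rw [hT.tracePreserving, hρ.2]⟩

theorem isState_inv_trace_smul {X : Matrix ι ι ℂ} (hX : X.PosSemidef) (h : X.trace ≠ 0) :
    IsState (X.trace⁻¹ • X) :=
  ⟨hX.smul (inv_nonneg.mpr hX.trace_nonneg), by simp [h]⟩

/-- Positive matrices span, and each is zero or a multiple of a state. Linear assertions can thus be
tested on states. -/
theorem span_isState : Submodule.span ℂ {ρ : Matrix ι ι ℂ | IsState ρ} = ⊤ := by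
  classical
  rw [eq_top_iff, ← CStarAlgebra.span_nonneg, Submodule.span_le]
  intro X hX
  have hX' : X.PosSemidef := Matrix.nonneg_iff_posSemidef.mp hX
  by_cases h : X.trace = 0
  · rw [hX'.trace_eq_zero_iff.mp h]
    exact Submodule.zero_mem _
  · have e : X = X.trace • (X.trace⁻¹ • X) := by rw [smul_smul, mul_inv_cancel₀ h, one_smul]
    rw [e]
    exact Submodule.smul_mem _ _ (Submodule.subset_span (isState_inv_trace_smul hX' h))

theorem IsChannel.apply_conjTranspose {T : Module.End ℂ (Matrix ι ι ℂ)} (hT : IsChannel T)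
    (X : Matrix ι ι ℂ) : T Xᴴ = (T X)ᴴ := by
  have hX : X ∈ Submodule.span ℂ {ρ : Matrix ι ι ℂ | IsState ρ} := by
    rw [span_isState]; exact Submodule.mem_top
  induction hX using Submodule.span_induction with
  | mem ρ hρ => rw [hρ.1.isHermitian, (hT.posSemidef_apply hρ.1).isHermitian]
  | zero => simp
  | add X Y _ _ hX hY => rw [Matrix.conjTranspose_add, map_add, hX, hY, map_add,
      Matrix.conjTranspose_add]
  | smul c X _ hX => rw [Matrix.conjTranspose_smul, map_smul, hX, map_smul,
      Matrix.conjTranspose_smul]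

/-- Positivity on e_i + u e_j, with the phase u turning the cross terms into −|ρ_ij|, gives 2|ρ_ij|
≤ ρ_ii + ρ_jj ≤ 2. -/
theorem IsState.norm_apply_le_one {ρ : Matrix ι ι ℂ} (hρ : IsState ρ) (i j : ι) :
    ‖ρ i j‖ ≤ 1 := by
  classical
  have hdiag (k : ι) : (ρ k k).re ≤ 1 := by
    have h : ∑ k, (ρ k k).re = 1 := by
      have := congrArg Complex.re hρ.2
      simpa [Matrix.trace] using this
    rw [← h]
    exact Finset.single_le_sum (f := fun k => (ρ k k).re)
      (fun k _ => (Complex.nonneg_iff.mp hρ.1.diag_nonneg).1) (Finset.mem_univ k)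
  by_cases h0 : ρ i j = 0
  · simp [h0]
  have hn : (‖ρ i j‖ : ℂ) ≠ 0 := by simpa using h0
  let u : ℂ := -(starRingEnd ℂ (ρ i j)) / ‖ρ i j‖
  have h1 : u * ρ i j = -‖ρ i j‖ := by
    simp only [u]
    rw [div_mul_eq_mul_div, neg_mul, Complex.conj_mul', div_eq_iff hn]
    ring
  have hu : starRingEnd ℂ u * u = 1 := by
    simp only [u, map_div₀, map_neg, Complex.conj_conj, Complex.conj_ofReal]
    rw [div_mul_div_comm, neg_mul_neg, Complex.mul_conj', ← sq, div_self (pow_ne_zero 2 hn)]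
  have hji : ρ j i = starRingEnd ℂ (ρ i j) := (hρ.1.isHermitian.apply j i).symm
  have h2 : starRingEnd ℂ u * ρ j i = -‖ρ i j‖ := by
    rw [hji, ← map_mul, h1]; simp
  have h := hρ.1.dotProduct_mulVec_nonneg (Pi.single i 1 + Pi.single j u)
  have e : star (Pi.single i 1 + Pi.single j u : ι → ℂ) ⬝ᵥ
      (ρ *ᵥ (Pi.single i 1 + Pi.single j u)) =
      ρ i i + u * ρ i j + starRingEnd ℂ u * ρ j i + starRingEnd ℂ u * u * ρ j j := by
    rw [star_add, Matrix.mulVec_add, add_dotProduct, dotProduct_add, dotProduct_add,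
      Pi.star_single, Pi.star_single]
    simp only [star_one, single_dotProduct, Matrix.mulVec_single, Complex.star_def,
      MulOpposite.op_one, Pi.smul_apply, Matrix.col_apply, one_mul, one_smul,
      MulOpposite.smul_eq_mul_unop, MulOpposite.unop_op]
    ring
  rw [e, h1, h2, hu] at h
  have h := (Complex.nonneg_iff.mp h).1
  simp at h
  linarith [hdiag i, hdiag j]

/-- The fixed points of a channel with a unique stationary state of full rank are the multiples of
this state. -/
theorem mem_span_of_apply_eq_self {T : Module.End ℂ (Matrix ι ι ℂ)} (hT : IsChannel T)
    {σ : Matrix ι ι ℂ} (hpos : σ.PosDef) (hfix : T σ = σ)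
    (huniq : ∀ ρ : Matrix ι ι ℂ, IsState ρ → T ρ = ρ → ρ = σ) {X : Matrix ι ι ℂ} (hX : T X = X) :
    X ∈ ℂ ∙ σ := by
  classical
  rcases isEmpty_or_nonempty ι with hι | hι
  · rw [Subsingleton.elim X 0]
    exact Submodule.zero_mem _
  -- Since σ ≥ r > 0 and H ≥ b, adding (|b|/r)σ makes a Hermitian fixed point positive; normalized,
  -- it is a stationary state unless it vanishes.
  have key (H : Matrix ι ι ℂ) (hH : Hᴴ = H) (hTH : T H = H) : H ∈ ℂ ∙ σ := by
    obtain ⟨r, hr, hrσ⟩ := (CFC.exists_pos_algebraMap_le_iff (A := Matrix ι ι ℂ) (a := σ)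
      hpos.isHermitian).2 fun x hx =>
        (Matrix.isStrictlyPositive_iff_posDef.mpr hpos).spectrum_pos hx
    obtain ⟨b, hb⟩ := H.finite_real_spectrum.bddBelow
    have hbH : algebraMap ℝ (Matrix ι ι ℂ) b ≤ H :=
      (algebraMap_le_iff_le_spectrum (p := IsSelfAdjoint) hH).mpr fun x hx => hb hx
    let s : ℝ := |b| / r
    have hs : 0 ≤ s := by positivity
    have hY : 0 ≤ H + s • σ := by
      have h1 : s • algebraMap ℝ (Matrix ι ι ℂ) r ≤ s • σ := smul_le_smul_of_nonneg_left hrσ hs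
      have h2 : s • algebraMap ℝ (Matrix ι ι ℂ) r = algebraMap ℝ _ |b| := by
        rw [Algebra.algebraMap_eq_smul_one, Algebra.algebraMap_eq_smul_one, smul_smul]
        congr 1
        simp only [s]
        field_simp
      calc 0 ≤ algebraMap ℝ (Matrix ι ι ℂ) (b + |b|) :=
            algebraMap_nonneg _ (by linarith [neg_abs_le b])
        _ = algebraMap ℝ (Matrix ι ι ℂ) b + algebraMap ℝ _ |b| := map_add _ _ _
        _ ≤ H + s • σ := add_le_add hbH (h2 ▸ h1)
    have hY' : (H + (s : ℂ) • σ).PosSemidef := Matrix.nonneg_iff_posSemidef.mp hY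
    have hTY : T (H + (s : ℂ) • σ) = H + (s : ℂ) • σ := by rw [map_add, map_smul, hTH, hfix]
    have hmem : H + (s : ℂ) • σ ∈ ℂ ∙ σ := by
      by_cases h : (H + (s : ℂ) • σ).trace = 0
      · rw [hY'.trace_eq_zero_iff.mp h]
        exact Submodule.zero_mem _
      · refine Submodule.mem_span_singleton.mpr ⟨(H + (s : ℂ) • σ).trace, ?_⟩
        have hu := huniq _ (isState_inv_trace_smul hY' h) (by rw [map_smul, hTY])
        refine (congrArg ((H + (s : ℂ) • σ).trace • ·) hu).symm.trans ?_
        simp only [smul_smul, mul_inv_cancel₀ h, one_smul]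
    simpa using Submodule.sub_mem _ hmem
      (Submodule.smul_mem _ (s : ℂ) (Submodule.mem_span_singleton_self σ))
  have hX' : T Xᴴ = Xᴴ := by rw [hT.apply_conjTranspose, hX]
  have h1 := key (X + Xᴴ) (by simp [add_comm]) (by rw [map_add, hX, hX'])
  have h2 := key (Complex.I • (X - Xᴴ)) (by simp [Matrix.conjTranspose_smul, ← smul_neg])
    (by rw [map_smul, map_sub, hX, hX'])
  have e : X = (1 / 2 : ℂ) • (X + Xᴴ) + (-Complex.I / 2) • (Complex.I • (X - Xᴴ)) := by
    rw [smul_smul, show -Complex.I / 2 * Complex.I = 1 / 2 by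
      rw [div_mul_eq_mul_div, neg_mul, Complex.I_mul_I]; norm_num, ← smul_add,
      add_add_sub_cancel, ← two_smul ℂ X, smul_smul]
    norm_num
  rw [e]
  exact Submodule.add_mem _ (Submodule.smul_mem _ _ h1) (Submodule.smul_mem _ _ h2)

/-- If the kernel of `N` is contained in the multiples of a matrix of trace one and `N` maps into
the traceless matrices, then `N` has no generalized kernel beyond its kernel. -/
theorem mem_span_of_pow_apply_eq_zero {N : Module.End ℂ (Matrix ι ι ℂ)} {σ : Matrix ι ι ℂ}
    (hσ : σ.trace = 1) (hker : ∀ X, N X = 0 → X ∈ ℂ ∙ σ)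
    (htr : ∀ X, N (N X) = 0 → (N X).trace = 0) (K : ℕ) {X : Matrix ι ι ℂ} (hX : (N ^ K) X = 0) :
    X ∈ ℂ ∙ σ := by
  have hσ0 : σ ≠ 0 := by rintro rfl; simp at hσ
  induction K generalizing X with
  | zero => rw [pow_zero, Module.End.one_apply] at hX; rw [hX]; exact Submodule.zero_mem _
  | succ K ih =>
    refine hker X ?_
    rw [pow_succ, Module.End.mul_apply] at hX
    obtain ⟨a, ha⟩ := Submodule.mem_span_singleton.mp (ih hX)
    by_contra h0
    have ha0 : a ≠ 0 := by rintro rfl; exact h0 (by rw [← ha, zero_smul])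
    have hKσ : (N ^ K) σ = 0 := by
      rw [← ha, map_smul] at hX
      exact (smul_eq_zero.mp hX).resolve_left ha0
    -- σ is an eigenvector of N killed by a power of N, so Nσ = 0. Then N(NX) = 0, and NX = aσ must
    -- be traceless, against a ≠ 0.
    obtain ⟨b, hb⟩ := Submodule.mem_span_singleton.mp (ih (X := N σ) (by
      rw [← Module.End.mul_apply, ← pow_succ, pow_succ', Module.End.mul_apply, hKσ, map_zero]))
    have hpow (k : ℕ) : (N ^ k) σ = b ^ k • σ := by
      induction k with
      | zero => simp
      | succ k ihk => rw [pow_succ', Module.End.mul_apply, ihk, map_smul, ← hb, smul_smul, pow_succ]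
    have hb0 : b = 0 := by
      rw [hpow] at hKσ
      exact eq_zero_of_pow_eq_zero ((smul_eq_zero.mp hKσ).resolve_right hσ0)
    have h := htr X (by rw [← ha, map_smul, ← hb, hb0, zero_smul, smul_zero])
    rw [← ha, Matrix.trace_smul, hσ, smul_eq_mul, mul_one] at h
    exact ha0 h

/-- The asymptotic part of a primitive channel replaces its input by the stationary state. -/
theorem peripheral_apply {T : Module.End ℂ (Matrix ι ι ℂ)} (hT : IsChannel T)
    (heig : ∀ μ : ℂ, T.HasEigenvalue μ → ‖μ‖ = 1 → μ = 1)
    {σ : Matrix ι ι ℂ} (hσ : IsState σ) (hpos : σ.PosDef) (hfix : T σ = σ)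
    (huniq : ∀ ρ : Matrix ι ι ℂ, IsState ρ → T ρ = ρ → ρ = σ) (X : Matrix ι ι ℂ) :
    peripheral T X = X.trace • σ := by
  have hσ0 : σ ≠ 0 := by rintro rfl; simpa using hσ.2
  have h1 : T.HasEigenvalue 1 :=
    Module.End.hasEigenvalue_of_hasEigenvector (x := σ)
      ⟨Module.End.mem_eigenspace_iff.mpr (by rw [hfix, one_smul]), hσ0⟩
  have hset : (Module.End.finite_spectrum T).toFinset.filter (fun μ : ℂ => ‖μ‖ = 1) = {1} := by
    ext μ
    simp only [Finset.mem_filter, Set.Finite.mem_toFinset, Finset.mem_singleton,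
      ← Module.End.hasEigenvalue_iff_mem_spectrum]
    exact ⟨fun h => heig μ h.1 h.2, by rintro rfl; exact ⟨h1, norm_one⟩⟩
  rw [peripheral, hset, Finset.sum_singleton, one_smul]
  have hle : T.maxGenEigenspace 1 ≤ ℂ ∙ σ := by
    intro Y hY
    obtain ⟨K, hK⟩ := (Module.End.mem_maxGenEigenspace T 1 Y).mp hY
    refine mem_span_of_pow_apply_eq_zero hσ.2 (fun Z hZ => ?_) (fun Z _ => ?_) K hK
    · refine mem_span_of_apply_eq_self hT hpos hfix huniq ?_
      simpa [sub_eq_zero] using hZ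
    · simp [hT.tracePreserving]
  have hzero : (⨆ ν : ℂ, ⨆ _ : ν ≠ 1, T.maxGenEigenspace ν) ≤
      LinearMap.ker (Matrix.traceLinearMap ι ℂ ℂ) := by
    refine iSup₂_le fun ν hν Y hY => ?_
    obtain ⟨K, hK⟩ := (Module.End.mem_maxGenEigenspace T ν Y).mp hY
    -- The trace is a left eigenvector of T for 1, so it vanishes on every other generalized
    -- eigenspace. Hence the projection of X is the multiple of σ with the trace of X.
    have htr (k : ℕ) : (((T - ν • 1) ^ k) Y).trace = (1 - ν) ^ k * Y.trace := by
      induction k with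
      | zero => simp
      | succ k ih =>
        rw [pow_succ', Module.End.mul_apply, LinearMap.sub_apply, Matrix.trace_sub,
          hT.tracePreserving, LinearMap.smul_apply, Module.End.one_apply, Matrix.trace_smul, ih,
          smul_eq_mul, pow_succ]
        ring
    have h := htr K
    rw [hK, Matrix.trace_zero, eq_comm, mul_eq_zero] at h
    exact h.resolve_left (pow_ne_zero K (sub_ne_zero.mpr hν.symm))
  have hc := isCompl_maxGenEigenspace T 1
  obtain ⟨a, ha⟩ := Submodule.mem_span_singleton.mp
    (hle (Submodule.projection_apply_mem hc X : spectralProj T 1 X ∈ _))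
  have hker := hzero (Submodule.sub_projection_mem hc X : X - spectralProj T 1 X ∈ _)
  change Submodule.projection _ _ hc X = _
  rw [← ha] at hker ⊢
  have h : X.trace - a = 0 := by
    simpa [hσ.2] using hker
  rw [sub_eq_zero.mp h]

end Channel

/-! ### Generators of primitive semigroups -/

section Generator

open Filter Asymptotics

variable {ι : Type*} [Fintype ι] [DecidableEq ι]

/-- `L` generates a semigroup of channels which are primitive at positive times, with stationary
state `σ`. -/
structure IsPrimitiveGenerator (L : Module.End ℂ (Matrix ι ι ℂ)) (σ : Matrix ι ι ℂ) : Prop where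
  isChannel : ∀ t : ℝ, 0 ≤ t → IsChannel (semigroup L t)
  isState : IsState σ
  posDef : σ.PosDef
  apply_eq : ∀ t : ℝ, 0 < t → semigroup L t σ = σ
  eq_of_apply_eq : ∀ t : ℝ, 0 < t → ∀ ρ, IsState ρ → semigroup L t ρ = ρ → ρ = σ
  eq_one_of_norm_eq_one : ∀ t : ℝ, 0 < t → ∀ μ : ℂ, (semigroup L t).HasEigenvalue μ →
    ‖μ‖ = 1 → μ = 1

/-- One σ serves all times: T_t commutes with T_1, so T_t σ is stationary for T_1 and equals σ by
uniqueness. -/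
theorem exists_isPrimitiveGenerator {L : Module.End ℂ (Matrix ι ι ℂ)}
    (hchannel : ∀ t : ℝ, 0 ≤ t → IsChannel (semigroup L t))
    (hprimitive : ∀ t : ℝ, 0 < t → IsPrimitive (semigroup L t)) :
    ∃ σ, IsPrimitiveGenerator L σ := by
  obtain ⟨-, σ, hσ, hfix, hpos, huniq⟩ := hprimitive 1 one_pos
  have hfixed (t : ℝ) (ht : 0 < t) : semigroup L t σ = σ :=
    huniq _ ((hchannel t ht.le).isState_apply hσ) (by rw [semigroup_commute, hfix])
  refine ⟨σ, hchannel, hσ, hpos, hfixed, fun t ht ρ hρ h => ?_, fun t ht => (hprimitive t ht).1⟩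
  obtain ⟨-, σ', -, -, -, huniq'⟩ := hprimitive t ht
  rw [huniq' ρ hρ h, huniq' σ hσ (hfixed t ht)]

theorem exp_pi_div_abs_mul_I {y : ℝ} (hy : y ≠ 0) :
    Complex.exp ((Real.pi / |y| : ℝ) * (y * Complex.I)) = -1 := by
  have hy' : (y : ℂ) ≠ 0 := by exact_mod_cast hy
  rcases lt_or_gt_of_ne hy with hneg | hpos
  · have e : ((Real.pi / |y| : ℝ) : ℂ) * (y * Complex.I) = -(Real.pi * Complex.I) := by
      rw [abs_of_neg hneg]
      push_cast
      field_simp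
    rw [e, Complex.exp_neg, Complex.exp_pi_mul_I]
    norm_num
  · have e : ((Real.pi / |y| : ℝ) : ℂ) * (y * Complex.I) = Real.pi * Complex.I := by
      rw [abs_of_pos hpos]
      push_cast
      field_simp
    rw [e, Complex.exp_pi_mul_I]

theorem hasEigenvalue_of_mem_maxGenEigenspace {V : Type*} [AddCommGroup V] [Module ℂ V]
    {T : Module.End ℂ V} {ν : ℂ} {v : V} (hv : v ∈ T.maxGenEigenspace ν) (h0 : v ≠ 0) :
    T.HasEigenvalue ν := by
  obtain ⟨K, hK⟩ := (Module.End.mem_maxGenEigenspace T ν v).mp hv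
  refine Module.End.hasEigenvalue_of_hasGenEigenvalue (k := K) fun hbot => h0 ?_
  rw [← Submodule.mem_bot ℂ, ← hbot]
  exact Module.End.mem_genEigenspace_nat.mpr hK

namespace IsPrimitiveGenerator

variable {L : Module.End ℂ (Matrix ι ι ℂ)} {σ : Matrix ι ι ℂ}

theorem isBigO_one (h : IsPrimitiveGenerator L σ) (X : Matrix ι ι ℂ) (i j : ι) :
    (fun t : ℝ => semigroup L t X i j) =O[atTop] fun _ => (1 : ℝ) := by
  have hX : X ∈ Submodule.span ℂ {ρ : Matrix ι ι ℂ | IsState ρ} := by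
    rw [span_isState]; exact Submodule.mem_top
  induction hX using Submodule.span_induction with
  | mem ρ hρ =>
    refine IsBigO.of_bound 1 ?_
    filter_upwards [eventually_ge_atTop 0] with t ht
    simpa using ((h.isChannel t ht).isState_apply hρ).norm_apply_le_one i j
  | zero => simp only [map_zero, Matrix.zero_apply]; exact isBigO_zero _ _
  | add X Y _ _ hX hY => simpa only [map_add, Matrix.add_apply] using hX.add hY
  | smul c X _ hX =>
    simpa only [map_smul, Matrix.smul_apply, smul_eq_mul] using hX.const_mul_left c

/-- A positive real part contradicts boundedness of the orbits. A nonzero imaginary μ makes −1 an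
eigenvalue of T_t at t = π/|Im μ|, against primitivity. -/
theorem re_neg_of_hasEigenvalue (h : IsPrimitiveGenerator L σ) {μ : ℂ} (hμ : L.HasEigenvalue μ)
    (h0 : μ ≠ 0) : μ.re < 0 := by
  obtain ⟨X, hX⟩ := hμ.exists_hasEigenvector
  have hLX : L X = μ • X := hX.apply_eq_smul
  refine lt_of_le_of_ne (not_lt.mp fun hpos => ?_) fun hre => ?_
  · obtain ⟨i, j, hij⟩ : ∃ i j, X i j ≠ 0 := by
      by_contra! hz
      exact hX.2 (Matrix.ext hz)
    obtain ⟨C, hC⟩ := (h.isBigO_one X i j).bound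
    have ht : Tendsto (fun t : ℝ => Real.exp (t * μ.re) * ‖X i j‖) atTop atTop :=
      (Real.tendsto_exp_atTop.comp (tendsto_id.atTop_mul_const hpos)).atTop_mul_const
        (norm_pos_iff.mpr hij)
    obtain ⟨t, ht1, ht2⟩ := (hC.and (ht.eventually_gt_atTop C)).exists
    rw [semigroup_apply_of_apply_eq_smul hLX, Matrix.smul_apply, norm_smul, Complex.norm_exp] at ht1
    simp at ht1
    linarith
  · have him : μ.im ≠ 0 := fun him => h0 (Complex.ext hre him)
    have ht : 0 < Real.pi / |μ.im| := div_pos Real.pi_pos (abs_pos.mpr him)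
    have hexp : Complex.exp ((Real.pi / |μ.im| : ℝ) * μ) = -1 := by
      have e : μ = μ.im * Complex.I := by
        apply Complex.ext <;> simp [hre]
      calc Complex.exp ((Real.pi / |μ.im| : ℝ) * μ)
          = Complex.exp ((Real.pi / |μ.im| : ℝ) * (μ.im * Complex.I)) := by rw [← e]
        _ = -1 := exp_pi_div_abs_mul_I him
    have heig : (semigroup L (Real.pi / |μ.im|)).HasEigenvalue (-1) :=
      Module.End.hasEigenvalue_of_hasEigenvector (x := X)
        ⟨Module.End.mem_eigenspace_iff.mpr (by
          rw [semigroup_apply_of_apply_eq_smul hLX, hexp]), hX.2⟩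
    have := h.eq_one_of_norm_eq_one _ ht _ heig (by simp)
    norm_num at this

theorem maxGenEigenspace_zero_le (h : IsPrimitiveGenerator L σ) :
    L.maxGenEigenspace 0 ≤ ℂ ∙ σ := by
  intro X hX
  obtain ⟨K, hK⟩ := (Module.End.mem_maxGenEigenspace L 0 X).mp hX
  rw [zero_smul, sub_zero] at hK
  refine mem_span_of_pow_apply_eq_zero h.isState.2 (fun Y hY => ?_) (fun Y hY => ?_) K hK
  · refine mem_span_of_apply_eq_self (h.isChannel 1 zero_le_one) h.posDef (h.apply_eq 1 one_pos)
      (h.eq_of_apply_eq 1 one_pos) ?_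
    rw [semigroup_apply_of_apply_eq_smul (μ := 0) (by rw [hY, zero_smul])]
    simp
  -- As L²Y = 0 the series stops after its linear term, so trace preservation forces tr(LY) = 0.
  · have e : semigroup L 1 Y = Y + L Y := by
      rw [semigroup_apply_of_mem_maxGenEigenspace (μ := 0) (K := 2) (by simpa [pow_two] using hY)]
      simp [Finset.sum_range_succ]
    have := (h.isChannel 1 zero_le_one).tracePreserving Y
    rw [e, Matrix.trace_add] at this
    simpa using this

theorem gap_le (h : IsPrimitiveGenerator L σ) {μ : ℂ} (hμ : L.HasEigenvalue μ) (h0 : μ ≠ 0) :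
    gap L ≤ -μ.re := by
  have hre := h.re_neg_of_hasEigenvalue hμ h0
  refine csInf_le ⟨0, ?_⟩ ⟨μ, ⟨hμ.mem_spectrum, hre⟩, abs_of_neg hre⟩
  rintro _ ⟨z, -, rfl⟩
  exact abs_nonneg _

theorem isBigO_of_mem_iSup (h : IsPrimitiveGenerator L σ) {a : ℝ} (ha : a < gap L)
    {X : Matrix ι ι ℂ} (hX : X ∈ ⨆ ν : ℂ, ⨆ _ : ν ≠ 0, L.maxGenEigenspace ν) (i j : ι) :
    (fun t : ℝ => semigroup L t X i j) =O[atTop] fun t => Real.exp (-a * t) := by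
  let W : Submodule ℂ (Matrix ι ι ℂ) :=
    { carrier := {X | (fun t : ℝ => semigroup L t X i j) =O[atTop] fun t => Real.exp (-a * t)}
      zero_mem' := by simpa using isBigO_zero _ _
      add_mem' := fun {X Y} hX hY => by
        simpa only [Set.mem_ofPred_eq, map_add, Matrix.add_apply] using hX.add hY
      smul_mem' := fun c X hX => by
        simpa only [Set.mem_ofPred_eq, map_smul, Matrix.smul_apply, smul_eq_mul] using
          IsBigO.const_mul_left hX c }
  have hle : (⨆ ν : ℂ, ⨆ _ : ν ≠ 0, L.maxGenEigenspace ν) ≤ W := by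
    refine iSup₂_le fun ν hν Y hY => ?_
    by_cases hY0 : Y = 0
    · rw [hY0]; exact W.zero_mem
    have hν' := hasEigenvalue_of_mem_maxGenEigenspace hY hY0
    exact isBigO_semigroup_of_mem_maxGenEigenspace hY (by linarith [h.gap_le hν' hν]) i j
  exact hle hX

theorem exists_eq_smul_add (h : IsPrimitiveGenerator L σ) (X : Matrix ι ι ℂ) :
    ∃ a : ℂ, ∃ Y ∈ ⨆ ν : ℂ, ⨆ _ : ν ≠ 0, L.maxGenEigenspace ν, X = a • σ + Y := by
  have hX : X ∈ L.maxGenEigenspace 0 ⊔ ⨆ ν : ℂ, ⨆ _ : ν ≠ 0, L.maxGenEigenspace ν := by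
    rw [(isCompl_maxGenEigenspace L 0).sup_eq_top]; exact Submodule.mem_top
  obtain ⟨Z, hZ, Y, hY, rfl⟩ := Submodule.mem_sup.mp hX
  obtain ⟨a, rfl⟩ := Submodule.mem_span_singleton.mp (h.maxGenEigenspace_zero_le hZ)
  exact ⟨a, Y, hY, rfl⟩

/-- The infimum runs over a finite set, which must be shown nonempty (otherwise `sInf` would be 0).
Were it empty, every matrix would be a multiple of σ, but an off-diagonal matrix unit is traceless
and nonzero. -/
theorem gap_attained (h : IsPrimitiveGenerator L σ) [Nontrivial ι] :
    ∃ μ : ℂ, L.HasEigenvalue μ ∧ μ.re = -gap L ∧ μ.re < 0 := by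
  have hfin : ((fun z : ℂ => |z.re|) '' {z : ℂ | z ∈ spectrum ℂ L ∧ z.re < 0}).Finite :=
    ((Module.End.finite_spectrum L).subset fun z hz => hz.1).image _
  have hne : ((fun z : ℂ => |z.re|) '' {z : ℂ | z ∈ spectrum ℂ L ∧ z.re < 0}).Nonempty := by
    by_contra hemp
    have hbot : (⨆ ν : ℂ, ⨆ _ : ν ≠ 0, L.maxGenEigenspace ν) = ⊥ := by
      refine eq_bot_iff.mpr (iSup₂_le fun ν hν Y hY => ?_)
      by_contra hY0
      have hν' := hasEigenvalue_of_mem_maxGenEigenspace hY hY0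
      exact hemp ⟨_, ν, ⟨hν'.mem_spectrum, h.re_neg_of_hasEigenvalue hν' hν⟩, rfl⟩
    obtain ⟨i, j, hij⟩ := exists_pair_ne ι
    obtain ⟨a, Y, hY, hX⟩ := h.exists_eq_smul_add (Matrix.single i j 1)
    rw [hbot, Submodule.mem_bot] at hY
    subst hY
    have ha := congrArg Matrix.trace hX
    rw [Matrix.trace_single_eq_of_ne i j 1 hij, add_zero, Matrix.trace_smul, h.isState.2,
      smul_eq_mul, mul_one] at ha
    rw [← ha, zero_smul, add_zero] at hX
    have := congrFun (congrFun hX i) j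
    simp at this
  obtain ⟨μ, ⟨hμ, hre⟩, habs⟩ := hne.csInf_mem hfin
  refine ⟨μ, Module.End.hasEigenvalue_iff_mem_spectrum.mpr hμ, ?_, hre⟩
  have : |μ.re| = gap L := habs
  rw [abs_of_neg hre] at this
  linarith

theorem gap_pos (h : IsPrimitiveGenerator L σ) [Nontrivial ι] : 0 < gap L := by
  obtain ⟨μ, -, h1, h2⟩ := h.gap_attained
  linarith

/-- Convergence to the stationary state at every rate below the gap. -/
theorem isBigO_sub (h : IsPrimitiveGenerator L σ) [Nontrivial ι] {a : ℝ} (ha : a < gap L)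
    (X : Matrix ι ι ℂ) (i j : ι) :
    (fun t : ℝ => (semigroup L t X - X.trace • σ) i j) =O[atTop] fun t => Real.exp (-a * t) := by
  obtain ⟨b, Y, hY, rfl⟩ := h.exists_eq_smul_add X
  -- The trace of T_t(Y) is constant in t and tends to 0.
  have htr : Y.trace = 0 := by
    have ht : Tendsto (fun t : ℝ => (semigroup L t Y).trace) atTop (nhds 0) := by
      have h0 : Tendsto (fun t : ℝ => Real.exp (-(gap L / 2) * t)) atTop (nhds 0) :=
        Real.tendsto_exp_atBot.comp
          (tendsto_id.const_mul_atTop_of_neg (by linarith [h.gap_pos]))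
      have := tendsto_finsetSum Finset.univ fun k (_ : k ∈ Finset.univ) =>
        (h.isBigO_of_mem_iSup (half_lt_self h.gap_pos) hY k k).trans_tendsto h0
      simpa [Matrix.trace] using this
    refine tendsto_nhds_unique (tendsto_const_nhds.congr' ?_) ht
    filter_upwards [eventually_ge_atTop 0] with t ht
    rw [(h.isChannel t ht).tracePreserving]
  refine (h.isBigO_of_mem_iSup ha hY i j).congr' ?_ EventuallyEq.rfl
  filter_upwards [eventually_gt_atTop 0] with t ht
  rw [map_add, map_smul, h.apply_eq t ht, Matrix.trace_add, htr, Matrix.trace_smul, h.isState.2]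
  simp

end IsPrimitiveGenerator

end Generator

/-! ### Contraction on separable states -/

section Separable

variable {ι : Type*} [Fintype ι]

theorem convex_setOf_isState : Convex ℝ {ρ : Matrix ι ι ℂ | IsState ρ} := by
  intro ρ hρ τ hτ a b ha hb hab
  refine ⟨(hρ.1.smul ha).add (hτ.1.smul hb), ?_⟩
  rw [Matrix.trace_add, Matrix.trace_smul, Matrix.trace_smul, hρ.2, hτ.2, ← add_smul, hab,
    one_smul]

variable [DecidableEq ι] {n : ℕ}

theorem isState_tensorPow_apply {T : Module.End ℂ (Matrix ι ι ℂ)}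
    (hT : ∀ ρ, IsState ρ → IsState (T ρ)) {ρ : Matrix (Fin n → ι) (Fin n → ι) ℂ}
    (hρ : ρ ∈ separableStates ι n) : IsState (tensorPow n T ρ) := by
  have hc := convex_setOf_isState.linear_preimage ((tensorPow n T).restrictScalars ℝ)
  refine convexHull_min ?_ hc hρ
  rintro _ ⟨τ, hτ, rfl⟩
  change IsState (tensorPow n T (tensorMatrix τ))
  rw [tensorPow_tensorMatrix]
  exact isState_tensorMatrix fun i => hT _ (hτ i)

variable {T : Module.End ℂ (Matrix ι ι ℂ)} {σ : Matrix ι ι ℂ}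

theorem traceDist_tensorPow_le_one (hT : IsChannel T) (hσ : IsState σ)
    (hper : ∀ X, peripheral T X = X.trace • σ) {ρ : Matrix (Fin n → ι) (Fin n → ι) ℂ}
    (hρ : ρ ∈ separableStates ι n) :
    traceDist (tensorPow n T ρ) (tensorPow n (peripheral T) ρ) ≤ 1 :=
  traceDist_le_one (isState_tensorPow_apply (fun _ h => hT.isState_apply h) hρ)
    (isState_tensorPow_apply (fun τ h => by rwa [hper, h.2, one_smul]) hρ)

theorem sepContraction_nonneg (n : ℕ) (T : Module.End ℂ (Matrix ι ι ℂ)) :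
    0 ≤ sepContraction n T := by
  refine Real.sSup_nonneg ?_
  rintro _ ⟨ρ, -, rfl⟩
  exact mul_nonneg (by norm_num) (traceNorm_nonneg _)

theorem sepContraction_le_one (hT : IsChannel T) (hσ : IsState σ)
    (hper : ∀ X, peripheral T X = X.trace • σ) : sepContraction n T ≤ 1 := by
  refine Real.sSup_le ?_ zero_le_one
  rintro _ ⟨ρ, hρ, rfl⟩
  exact traceDist_tensorPow_le_one hT hσ hper hρ

theorem traceDist_le_sepContraction (hT : IsChannel T) (hσ : IsState σ)
    (hper : ∀ X, peripheral T X = X.trace • σ) {ρ : Matrix ι ι ℂ} (hρ : IsState ρ) :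
    traceDist (tensorMatrix fun _ : Fin n => T ρ) (tensorMatrix fun _ => σ) ≤
      sepContraction n T := by
  refine le_csSup ⟨1, ?_⟩ ⟨tensorMatrix fun _ => ρ,
    subset_convexHull ℝ _ ⟨fun _ => ρ, fun _ => hρ, rfl⟩, ?_⟩
  · rintro _ ⟨τ, hτ, rfl⟩
    exact traceDist_tensorPow_le_one hT hσ hper hτ
  · simp only [tensorPow_tensorMatrix, hper, hρ.2, one_smul]

theorem sepContraction_le_sqrt (hT : IsChannel T) (hσ : IsState σ) (hpos : σ.PosDef)
    (hper : ∀ X, peripheral T X = X.trace • σ) {δ : ℝ}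
    (hδ : ∀ ρ, IsState ρ → chiSq (T ρ) σ ≤ δ) :
    sepContraction n T ≤ Real.sqrt (Real.exp (n * δ) - 1) := by
  refine Real.sSup_le ?_ (Real.sqrt_nonneg _)
  rintro _ ⟨ρ, hρ, rfl⟩
  have h1 := isState_tensorPow_apply (fun _ h => hT.isState_apply h) hρ
  have h2 : IsState (tensorPow n (peripheral T) ρ) :=
    isState_tensorPow_apply (fun τ h => by rwa [hper, h.2, one_smul]) hρ
  obtain ⟨E, hE0, hE1, hE⟩ := exists_effect_eq_traceNorm
    (X := tensorPow n T ρ - tensorPow n (peripheral T) ρ)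
    (h1.1.isHermitian.sub h2.1.isHermitian) (by simp [h1.2, h2.2])
  simp only [traceDist]
  rw [hE]
  -- With the effect optimal for ρ now frozen, the bias is linear in the input, and the bound on
  -- product states, uniform in the effect, passes to the convex hull.
  let φ : Matrix (Fin n → ι) (Fin n → ι) ℂ →ₗ[ℝ] ℝ :=
    Complex.reLm ∘ₗ (Matrix.traceLinearMap (Fin n → ι) ℂ ℂ ∘ₗ LinearMap.mulLeft ℂ E ∘ₗ
      (tensorPow n T - tensorPow n (peripheral T))).restrictScalars ℝ
  have hc : Convex ℝ {τ | φ τ ≤ Real.sqrt (Real.exp (n * δ) - 1)} :=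
    convex_halfSpace_le φ.isLinear _
  refine convexHull_min ?_ hc hρ
  rintro _ ⟨τ, hτ, rfl⟩
  change (E * (tensorPow n T (tensorMatrix τ) -
    tensorPow n (peripheral T) (tensorMatrix τ))).trace.re ≤ _
  simp only [tensorPow_tensorMatrix, hper, (hτ _).2, one_smul]
  exact re_trace_effect_mul_tensorMatrix_sub_le hσ hpos (fun i => hT.isState_apply (hτ i))
    (fun i => hδ _ (hτ i)) hE0 hE1

end Separable

/-! ### Bounds for the semigroup -/

section SemigroupBounds

open Filter Asymptotics

variable {ι : Type*} [Fintype ι]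

theorem re_trace_mul_le_sum_norm (A : Matrix ι ι ℂ) {ρ : Matrix ι ι ℂ} (hρ : IsState ρ) :
    (A * ρ).trace.re ≤ ∑ i, ∑ j, ‖A i j‖ := by
  refine (Complex.re_le_norm _).trans ?_
  simp only [Matrix.trace, Matrix.diag, Matrix.mul_apply]
  refine (norm_sum_le _ _).trans (Finset.sum_le_sum fun i _ => (norm_sum_le _ _).trans
    (Finset.sum_le_sum fun j _ => ?_))
  rw [norm_mul]
  exact mul_le_of_le_one_right (norm_nonneg _) (hρ.norm_apply_le_one j i)

theorem exists_trace_mul_eq (l : Matrix ι ι ℂ →ₗ[ℂ] ℂ) :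
    ∃ W : Matrix ι ι ℂ, ∀ X, l X = (W * X).trace := by
  classical
  refine ⟨Matrix.of fun j i => l (Matrix.single i j 1), fun X => ?_⟩
  conv_lhs => rw [Matrix.matrix_eq_sum_single X]
  simp only [map_sum, Matrix.trace, Matrix.diag, Matrix.mul_apply, Matrix.of_apply]
  rw [Finset.sum_comm]
  refine Finset.sum_congr rfl fun j _ => Finset.sum_congr rfl fun i _ => ?_
  rw [← mul_one (X i j), ← smul_eq_mul, ← Matrix.smul_single, map_smul, smul_eq_mul, smul_eq_mul,
    mul_one, mul_comm]

/-- The Hermitian part of `u • W`, for a phase `u`, as an observable. -/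
theorem exists_observable (W : Matrix ι ι ℂ) {u : ℂ} (hu : star u * u = 1) :
    ∃ H : Matrix ι ι ℂ, IsSelfAdjoint H ∧
      (∀ X : Matrix ι ι ℂ, Xᴴ = X → (H * X).trace = ((u * (W * X).trace).re : ℂ)) ∧
      H * H ≤ (1 / 2 : ℝ) • (W * Wᴴ + Wᴴ * W) := by
  let V := u • W
  have hV1 : V * Vᴴ = W * Wᴴ := by
    simp only [V, Matrix.conjTranspose_smul, Matrix.smul_mul, Matrix.mul_smul, smul_smul]
    rw [hu, one_smul]
  have hV2 : Vᴴ * V = Wᴴ * W := by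
    simp only [V, Matrix.conjTranspose_smul, Matrix.smul_mul, Matrix.mul_smul, smul_smul]
    rw [mul_comm, hu, one_smul]
  refine ⟨(1 / 2 : ℝ) • (V + Vᴴ), ?_, fun X hX => ?_, ?_⟩
  · exact IsSelfAdjoint.smul (.all _) (IsSelfAdjoint.add_star_self V)
  · have h1 : (V * X).trace = u * (W * X).trace := by simp [V]
    have h2 : (Vᴴ * X).trace = star (u * (W * X).trace) := by
      rw [← h1, ← Matrix.trace_conjTranspose, Matrix.conjTranspose_mul, hX, Matrix.trace_mul_comm]
    rw [Matrix.smul_mul, Matrix.trace_smul, Matrix.add_mul, Matrix.trace_add, h1, h2]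
    apply Complex.ext <;> simp <;> ring
  -- The difference is (V − V†)(V − V†)†/4. The bound does not involve the phase u, so it will be
  -- uniform in t.
  · rw [Matrix.le_iff, ← hV1, ← hV2]
    have h := (Matrix.posSemidef_self_mul_conjTranspose (V - Vᴴ)).smul
      (show (0 : ℝ) ≤ 1 / 4 by norm_num)
    have e : (1 / 2 : ℝ) • (V * Vᴴ + Vᴴ * V) -
        ((1 / 2 : ℝ) • (V + Vᴴ)) * ((1 / 2 : ℝ) • (V + Vᴴ)) =
        (1 / 4 : ℝ) • ((V - Vᴴ) * (V - Vᴴ)ᴴ) := by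
      rw [Matrix.conjTranspose_sub, Matrix.conjTranspose_conjTranspose]
      simp only [Matrix.smul_mul, Matrix.mul_smul, Matrix.add_mul, Matrix.mul_add,
        Matrix.sub_mul, Matrix.mul_sub]
      module
    rw [e]
    exact h

variable [DecidableEq ι]

/-- χ² is quadratic in the deviation, hence decays at twice its rate; this is the factor 2 in the
cutoff time. -/
theorem chiSq_le {ρ σ : Matrix ι ι ℂ} {ε : ℝ} (h : ∀ i j, ‖(ρ - σ) i j‖ ≤ ε) :
    chiSq ρ σ ≤ (∑ _i : ι, ∑ j, ∑ k, ‖σ⁻¹ k j‖) * ε ^ 2 := by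
  refine (Complex.re_le_norm _).trans ?_
  simp only [Matrix.trace, Matrix.diag, Matrix.mul_apply, Finset.sum_mul]
  refine (norm_sum_le _ _).trans (Finset.sum_le_sum fun i _ => (norm_sum_le _ _).trans
    (Finset.sum_le_sum fun j _ => (norm_sum_le _ _).trans (Finset.sum_le_sum fun k _ => ?_)))
  have hε : 0 ≤ ε := (norm_nonneg _).trans (h i k)
  rw [norm_mul, norm_mul]
  calc ‖(ρ - σ) i k‖ * ‖σ⁻¹ k j‖ * ‖(ρ - σ) j i‖ ≤ ε * ‖σ⁻¹ k j‖ * ε := by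
        gcongr
        · exact h i k
        · exact h j i
    _ = ‖σ⁻¹ k j‖ * ε ^ 2 := by ring

namespace IsPrimitiveGenerator

variable {L : Module.End ℂ (Matrix ι ι ℂ)} {σ : Matrix ι ι ℂ}

theorem peripheral_semigroup_apply (h : IsPrimitiveGenerator L σ) {t : ℝ} (ht : 0 < t)
    (X : Matrix ι ι ℂ) : peripheral (semigroup L t) X = X.trace • σ :=
  peripheral_apply (h.isChannel t ht.le) (h.eq_one_of_norm_eq_one t ht) h.isState h.posDef
    (h.apply_eq t ht) (h.eq_of_apply_eq t ht) X

theorem exists_chiSq_le (h : IsPrimitiveGenerator L σ) [Nontrivial ι] {a : ℝ} (ha : a < gap L) :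
    ∃ C : ℝ, ∀ᶠ t : ℝ in atTop, ∀ ρ, IsState ρ →
      chiSq (semigroup L t ρ) σ ≤ C * Real.exp (-(2 * a) * t) := by
  -- Uniformity over states: their entries have modulus at most 1, so decay of Φ on the finitely
  -- many matrix units suffices.
  let Φ (t : ℝ) : Module.End ℂ (Matrix ι ι ℂ) :=
    semigroup L t - (Matrix.traceLinearMap ι ℂ ℂ).smulRight σ
  have hΦ (i j : ι) (kl : ι × ι) : (fun t : ℝ => ‖Φ t (Matrix.single kl.1 kl.2 1) i j‖) =O[atTop]
      fun t => Real.exp (-a * t) := (h.isBigO_sub ha (Matrix.single kl.1 kl.2 1) i j).norm_left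
  have hsum : (fun t : ℝ => ∑ i, ∑ j, ∑ kl : ι × ι, ‖Φ t (Matrix.single kl.1 kl.2 1) i j‖)
      =O[atTop] fun t => Real.exp (-a * t) :=
    IsBigO.fun_sum fun i _ => IsBigO.fun_sum fun j _ => IsBigO.fun_sum fun kl _ => hΦ i j kl
  obtain ⟨C, hC⟩ := hsum.bound
  refine ⟨(∑ _i : ι, ∑ j, ∑ k, ‖σ⁻¹ k j‖) * C ^ 2, ?_⟩
  filter_upwards [hC] with t ht ρ hρ
  have hent (i j : ι) : ‖(semigroup L t ρ - σ) i j‖ ≤ C * Real.exp (-a * t) := by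
    have e : semigroup L t ρ - σ = Φ t ρ := by simp [Φ, hρ.2]
    rw [e, end_apply_eq_sum]
    rw [Real.norm_of_nonneg (by positivity), Real.norm_of_nonneg (Real.exp_pos _).le] at ht
    refine le_trans ?_ ht
    calc ‖∑ kl : ι × ι, ρ kl.1 kl.2 * Φ t (Matrix.single kl.1 kl.2 1) i j‖
        ≤ ∑ kl : ι × ι, ‖Φ t (Matrix.single kl.1 kl.2 1) i j‖ := by
          refine (norm_sum_le _ _).trans (Finset.sum_le_sum fun kl _ => ?_)
          rw [norm_mul]
          exact mul_le_of_le_one_left (norm_nonneg _) (hρ.norm_apply_le_one _ _)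
      _ ≤ ∑ j, ∑ kl : ι × ι, ‖Φ t (Matrix.single kl.1 kl.2 1) i j‖ :=
          Finset.single_le_sum (f := fun j => ∑ kl : ι × ι, ‖Φ t (Matrix.single kl.1 kl.2 1) i j‖)
            (fun j _ => by positivity) (Finset.mem_univ j)
      _ ≤ _ :=
          Finset.single_le_sum
            (f := fun i => ∑ j, ∑ kl : ι × ι, ‖Φ t (Matrix.single kl.1 kl.2 1) i j‖)
            (fun i _ => by positivity) (Finset.mem_univ i)
  refine (chiSq_le hent).trans (le_of_eq ?_)
  rw [mul_pow, ← Real.exp_nat_mul]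
  push_cast
  ring_nf

/-- Some initial state approaches the stationary state no faster than at the rate of the gap, as
witnessed by observables of bounded variance. -/
theorem exists_observable_eq (h : IsPrimitiveGenerator L σ) [Nontrivial ι] :
    ∃ ρ : Matrix ι ι ℂ, ∃ m K : ℝ, IsState ρ ∧ 0 < m ∧ ∀ t : ℝ, 0 < t →
      ∃ H : Matrix ι ι ℂ, IsSelfAdjoint H ∧ (H * σ).trace = 0 ∧
        (H * semigroup L t ρ).trace = ((m * Real.exp (-gap L * t) : ℝ) : ℂ) ∧
        ∀ τ, IsState τ → (H * H * τ).trace.re ≤ K := by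
  obtain ⟨μ, hμ, hgap, hre⟩ := h.gap_attained
  -- In finite dimension L − μ is not surjective; a nonzero functional vanishing on its range is a
  -- left eigenvector.
  have hrange : LinearMap.range (L - μ • 1) < ⊤ := by
    rw [lt_top_iff_ne_top, ne_eq, LinearMap.range_eq_top, ← LinearMap.injective_iff_surjective,
      ← LinearMap.ker_eq_bot]
    intro hbot
    apply hμ
    rw [← hbot, Module.End.genEigenspace_one]
  obtain ⟨l, hl0, hl⟩ := Submodule.exists_le_ker_of_lt_top _ hrange
  have hlL (X : Matrix ι ι ℂ) : l (L X) = μ * l X := by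
    have := hl (LinearMap.mem_range_self (L - μ • 1) X)
    simpa [sub_eq_zero] using this
  have hlT (t : ℝ) (X : Matrix ι ι ℂ) : l (semigroup L t X) = Complex.exp (t * μ) * l X :=
    apply_expEnd_of_comp_eq_smul (fun Y => by
      rw [LinearMap.smul_apply, map_smul, hlL, smul_eq_mul, mul_assoc]) X
  -- T_1 fixes σ, while l picks up the factor e^μ of modulus below 1.
  have hlσ : l σ = 0 := by
    have h1 := hlT 1 σ
    rw [h.apply_eq 1 one_pos] at h1
    have h2 : Complex.exp ((1 : ℝ) * μ) ≠ 1 := by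
      intro h2
      have h3 := congrArg norm h2
      rw [Complex.norm_exp] at h3
      simp at h3
      exact hre.ne h3
    by_contra h0
    exact h2 (mul_right_cancel₀ h0 (by rw [← h1, one_mul]))
  obtain ⟨ρ, hρ, hlρ⟩ : ∃ ρ, IsState ρ ∧ l ρ ≠ 0 := by
    by_contra! hz
    apply hl0
    refine LinearMap.ext_on_range (v := fun ρ : {ρ : Matrix ι ι ℂ | IsState ρ} => (ρ : Matrix ι ι ℂ))
      (by rw [Subtype.range_coe]; exact span_isState) fun ρ => ?_
    simpa using hz ρ ρ.2
  obtain ⟨W, hW⟩ := exists_trace_mul_eq l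
  refine ⟨ρ, ‖l ρ‖, ∑ i, ∑ j, ‖((1 / 2 : ℝ) • (W * Wᴴ + Wᴴ * W)) i j‖, hρ,
    norm_pos_iff.mpr hlρ, fun t ht => ?_⟩
  have hz : ‖l (semigroup L t ρ)‖ = ‖l ρ‖ * Real.exp (-gap L * t) := by
    rw [hlT, norm_mul, Complex.norm_exp, mul_comm]
    simp [hgap, mul_comm]
  set z := l (semigroup L t ρ) with hzdef
  have hz0 : (‖z‖ : ℂ) ≠ 0 := by
    have : 0 < ‖z‖ := by rw [hz]; have := norm_pos_iff.mpr hlρ; positivity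
    exact_mod_cast this.ne'
  -- For non-real μ the value z = l(T_t ρ) rotates with t; this phase turns it into |z|, so H
  -- depends on t.
  obtain ⟨H, hH, htr, hHH⟩ := exists_observable W (u := star z / ‖z‖) (by
    simp only [Complex.star_def, map_div₀, Complex.conj_conj, Complex.conj_ofReal]
    rw [div_mul_div_comm, Complex.mul_conj', ← sq, div_self (pow_ne_zero 2 hz0)])
  refine ⟨H, hH, ?_, ?_, fun τ hτ => ?_⟩
  · rw [htr σ h.isState.1.isHermitian, ← hW, hlσ]
    simp
  · rw [htr _ ((h.isChannel t ht.le).isState_apply hρ).1.isHermitian, ← hW, ← hz, ← hzdef,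
      div_mul_eq_mul_div, Complex.star_def, Complex.conj_mul', sq, mul_div_assoc, div_self hz0,
      mul_one, Complex.ofReal_re]
  · exact (re_trace_mul_le_re_trace_mul hHH hτ.1).trans (re_trace_mul_le_sum_norm _ hτ)

end IsPrimitiveGenerator

end SemigroupBounds

/-! ### The cutoff -/

section Cutoff

open Filter Topology

variable {ι : Type*} [Fintype ι] [DecidableEq ι] [Nontrivial ι]
  {L : Module.End ℂ (Matrix ι ι ℂ)} {σ : Matrix ι ι ℂ}

theorem tendsto_log_natCast_atTop : Tendsto (fun n : ℕ => Real.log n) atTop atTop :=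
  Real.tendsto_log_atTop.comp tendsto_natCast_atTop_atTop

theorem IsPrimitiveGenerator.tendsto_time (h : IsPrimitiveGenerator L σ) {c : ℝ} (hc : 0 < c) :
    Tendsto (fun n : ℕ => c * (Real.log n / (2 * gap L))) atTop atTop :=
  (tendsto_log_natCast_atTop.atTop_div_const (by linarith [h.gap_pos])).const_mul_atTop hc

theorem IsPrimitiveGenerator.tendsto_sepContraction_one (h : IsPrimitiveGenerator L σ) {c : ℝ}
    (hc : 0 < c) (hc1 : c < 1) :
    Tendsto (fun n : ℕ => sepContraction n (semigroup L (c * (Real.log n / (2 * gap L)))))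
      atTop (𝓝 1) := by
  have hgap := h.gap_pos
  obtain ⟨ρ, m, K, hρ, hm, hobs⟩ := h.exists_observable_eq
  have hlim : Tendsto (fun n : ℕ => 1 - 4 * K / (m ^ 2 * Real.exp ((1 - c) * Real.log n)))
      atTop (𝓝 1) := by
    have h1 : Tendsto (fun n : ℕ => m ^ 2 * Real.exp ((1 - c) * Real.log n)) atTop atTop :=
      (Real.tendsto_exp_atTop.comp (tendsto_log_natCast_atTop.const_mul_atTop
        (sub_pos.mpr hc1))).const_mul_atTop (by positivity)
    simpa using tendsto_const_nhds.sub (h1.const_div_atTop (4 * K))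
  refine tendsto_of_tendsto_of_tendsto_of_le_of_le' hlim tendsto_const_nhds ?_ ?_
  · filter_upwards [(h.tendsto_time hc).eventually_gt_atTop 0, eventually_gt_atTop 0] with n ht hn
    obtain ⟨H, hH, hHσ, hHρ, hK⟩ := hobs _ ht
    have hch := h.isChannel _ ht.le
    have hρt := hch.isState_apply hρ
    refine le_trans (le_of_eq ?_) ((one_sub_le_traceDist_tensorMatrix hn hρt h.isState hH
      (by positivity) hHσ hHρ (hK _ h.isState) (hK _ hρt)).trans
      (traceDist_le_sepContraction hch h.isState (h.peripheral_semigroup_apply ht) hρ))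
    -- What remains is n e^{-2·gap·t} = n^{1-c} at t = c log n / (2·gap).
    congr 2
    have hn' : (0 : ℝ) < n := by exact_mod_cast hn
    have e : (n : ℝ) = Real.exp (Real.log n) := (Real.exp_log hn').symm
    rw [mul_pow, ← Real.exp_nat_mul, mul_left_comm]
    nth_rw 2 [e]
    rw [← Real.exp_add]
    congr 2
    push_cast
    field_simp
    ring
  · filter_upwards [(h.tendsto_time hc).eventually_gt_atTop 0] with n ht
    exact sepContraction_le_one (h.isChannel _ ht.le) h.isState (h.peripheral_semigroup_apply ht)

theorem IsPrimitiveGenerator.tendsto_sepContraction_zero (h : IsPrimitiveGenerator L σ) {c : ℝ}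
    (hc1 : 1 < c) :
    Tendsto (fun n : ℕ => sepContraction n (semigroup L (c * (Real.log n / (2 * gap L)))))
      atTop (𝓝 0) := by
  have hgap := h.gap_pos
  have hc : 0 < c := by linarith
  -- With this rate a, 2at = ((c+1)/2) log n, so n e^{-2at} = n^{-(c-1)/2}.
  have ha : gap L * (c + 1) / (2 * c) < gap L := by
    rw [div_lt_iff₀ (by positivity)]
    nlinarith
  obtain ⟨C, hC⟩ := h.exists_chiSq_le ha
  have hlim : Tendsto (fun n : ℕ => Real.sqrt (Real.exp (C * Real.exp (-((c - 1) / 2) *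
      Real.log n)) - 1)) atTop (𝓝 0) := by
    have h1 : Tendsto (fun n : ℕ => Real.exp (-((c - 1) / 2) * Real.log n)) atTop (𝓝 0) :=
      Real.tendsto_exp_atBot.comp (tendsto_log_natCast_atTop.const_mul_atTop_of_neg (by linarith))
    have h2 : Continuous fun x : ℝ => Real.sqrt (Real.exp (C * x) - 1) := by fun_prop
    simpa [Function.comp_def] using (h2.tendsto 0).comp h1
  refine squeeze_zero' (Eventually.of_forall fun n => sepContraction_nonneg _ _) ?_ hlim
  filter_upwards [(h.tendsto_time hc).eventually_gt_atTop 0, eventually_gt_atTop 0,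
    (h.tendsto_time hc).eventually hC] with n ht hn hχ
  refine (sepContraction_le_sqrt (h.isChannel _ ht.le) h.isState h.posDef
    (h.peripheral_semigroup_apply ht) hχ).trans (le_of_eq ?_)
  have hn' : (0 : ℝ) < n := by exact_mod_cast hn
  congr 3
  rw [mul_left_comm]
  congr 1
  nth_rw 1 [← Real.exp_log hn']
  rw [← Real.exp_add]
  congr 1
  field_simp
  ring

end Cutoff

end QuantumCutoff

end

theorem proposition9 (d : ℕ) (hd : 2 ≤ d)
    (L : Module.End ℂ (Matrix (Fin d) (Fin d) ℂ))
    (hchannel : ∀ t : ℝ, 0 ≤ t → QuantumCutoff.IsChannel (QuantumCutoff.semigroup L t))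
    (hprimitive : ∀ t : ℝ, 0 < t → QuantumCutoff.IsPrimitive (QuantumCutoff.semigroup L t)) :
    QuantumCutoff.HasCutoff
      (fun n t => QuantumCutoff.sepContraction n (QuantumCutoff.semigroup L t))
      (fun n => Real.log n / (2 * QuantumCutoff.gap L)) := by
  have : Nontrivial (Fin d) := Fin.nontrivial_iff_two_le.mpr hd
  obtain ⟨σ, h⟩ := QuantumCutoff.exists_isPrimitiveGenerator hchannel hprimitive
  exact fun c hc => ⟨fun hc1 => h.tendsto_sepContraction_one hc hc1,
    fun hc1 => h.tendsto_sepContraction_zero hc1⟩
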